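/- Let $d\ge 1$. Let $\mathcal A=\overline{\bigotimes_{\mathbb Z}M_d(\mathbb C)}$ be the UHF algebra of the quantum spin chain, with lattice translations $\gamma_j$, $j\in\mathbb Z$. For $n\in\mathbb N$ let $\mathcal A_n=\bigotimes_{[-n,n]}M_d(\mathbb C)\subset\mathcal A$, let $\operatorname{Tr}_n$ be the non-normalized trace on $\mathcal A_n$, and let $S_\gamma$ be the set of translation invariant states of $\mathcal A$. For $\omega\in S_\gamma$ let $$s(\omega)=\lim_{n\to\infty}\frac{1}{2n+1}S_{[-n,n]}(\omega)$$ be the mean entropy, where $S_{[-n,n]}(\omega)$ is the von Neumann entropy $-\operatorname{Tr}_n\rho\log\rho$ of the density matrix $\rho$ of $\omega|_{\mathcal A_n}$ (the limit exists). Fix self-adjoint $A_1,\dots,A_m\in M_d(\mathbb C)$, identified with elements of the algebra at site $0$, and put $$H_{i,n}=\frac{1}{2n+1}\sum_{j=-n}^{n}\gamma_j(A_i)\in\mathcal A_n .$$ Define $\mu:\mathbb R^m\to[-\infty,\infty)$ by $$\mu(x)=\sup\{s(\omega):\omega\in S_\gamma,\ \omega(A_i)=x_i \text{ for } 1\le i\le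 m\},\qquad \sup\emptyset=-\infty .$$ Let $C$ be a nonempty compact convex subset of $\mathbb R^m$, let $(n_k)_k$ be a strictly increasing sequence in $\mathbb N$, and let $p_k\in\mathcal A_{n_k}$ be projections. Suppose that for every $\varepsilon>0$, for all sufficiently large $k$, $p_k\neq 0$ and $$\left(\frac{\operatorname{Tr}_{n_k}p_kH_{1,n_k}}{\operatorname{Tr}_{n_k}p_k},\dots,\frac{\operatorname{Tr}_{n_k}p_kH_{m,n_k}}{\operatorname{Tr}_{n_k}p_k}\right)\in C_\varepsilon ,$$ where $C_\varepsilon$ is the $\varepsilon$-neighbourhood of $C$. Then $$\limsup_{k\to\infty}\frac{1}{2n_k+1}\log\operatorname{Tr}_{n_k}p_k\ \le\ \sup\{\mu(x):x\in C\}.$$ -/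

import Mathlib

open Filter Topology
open scoped ComplexOrder InnerProductSpace

noncomputable section

namespace SpinChain

/-! ### Local algebras -/

/-- The local algebra `⨂_{Λ} M_d(ℂ)` of a finite region `Λ ⊂ ℤ`, written as the algebra of complex
matrices whose rows and columns are indexed by the spin configurations on `Λ`. -/
abbrev LocalAlg (d : ℕ) (Λ : Finset ℤ) : Type :=
  Matrix (Λ → Fin d) (Λ → Fin d) ℂ

/-- The interval `[-n, n] ⊂ ℤ`. -/
abbrev box (n : ℕ) : Finset ℤ := Finset.Icc (-(n : ℤ)) (n : ℤ)

/-- The elementary tensor in `⨂_{Λ} M_d(ℂ)` with the matrix `A` at the site `j` and the identity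
matrix at all other sites. -/
def siteMatrix {d : ℕ} {Λ : Finset ℤ} (j : Λ) (A : Matrix (Fin d) (Fin d) ℂ) : LocalAlg d Λ :=
  Matrix.of fun s t => if ∀ k : Λ, k ≠ j → s k = t k then A (s j) (t j) else 0

/-- The spatial mean `(2 n + 1)⁻¹ ∑_{j = -n}^{n} γ_j(A)`, an element of `⨂_{[-n, n]} M_d(ℂ)`. -/
def spatialMean {d : ℕ} (n : ℕ) (A : Matrix (Fin d) (Fin d) ℂ) : LocalAlg d (box n) :=
  (2 * (n : ℂ) + 1)⁻¹ • ∑ j : box n, siteMatrix j A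

/-! ### The quasi-local UHF algebra

It is realized as a concrete C*-algebra: every local algebra acts faithfully on the Hilbert space
`ℓ²` over the set of all spin configurations `ℤ → Fin d`, by acting on the coordinates in `Λ` and
leaving all others alone; the quasi-local algebra is the norm closure of the union of the local
algebras in this representation. -/

/-- Spin configurations on the whole chain. -/
abbrev Config (d : ℕ) : Type := ℤ → Fin d

/-- The Hilbert space `ℓ²(ℤ → Fin d)`. -/
abbrev HilbertSp (d : ℕ) : Type := lp (fun _ : Config d => ℂ) 2

section PartialTranslation

variable {S : Type*}

theorem sum_elim_le (f : S ≃. S) (h : S → ℝ) {C : ℝ}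
    (hC : ∀ s : Finset S, ∑ x ∈ s, h x ≤ C) (s : Finset S) :
    ∑ x ∈ s, (f x).elim 0 h ≤ C := by
  classical
  refine le_trans (le_of_eq ?_) (hC (s.biUnion fun x => (f x).toFinset))
  rw [Finset.sum_biUnion]
  · refine Finset.sum_congr rfl fun x _ => ?_
    cases f x <;> simp
  · intro x _ y _ hxy
    simp only [Function.onFun, Finset.disjoint_left, Option.mem_toFinset]
    intro a ha hb
    exact hxy (f.inj ha hb)

/-- The operator on `ℓ²(S)` induced by a partial bijection `f` of `S`:
`ψ ↦ (x ↦ ψ (f x) if f x is defined, and 0 otherwise)`. -/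
def pequivOp (f : S ≃. S) :
    lp (fun _ : S => ℂ) 2 →L[ℂ] lp (fun _ : S => ℂ) 2 :=
  have key : ∀ (ψ : lp (fun _ : S => ℂ) 2) (s : Finset S),
      ∑ x ∈ s, ‖(f x).elim 0 (ψ : S → ℂ)‖ ^ (2 : ENNReal).toReal ≤ ‖ψ‖ ^ (2 : ENNReal).toReal := by
    intro ψ s
    have h := sum_elim_le f (fun x => ‖ψ x‖ ^ (2 : ENNReal).toReal)
      (fun s => lp.sum_rpow_le_norm_rpow (by norm_num) ψ s) s
    refine le_trans (le_of_eq (Finset.sum_congr rfl fun x _ => ?_)) h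
    cases f x <;> simp
  LinearMap.mkContinuous
    { toFun := fun ψ => ⟨fun x => (f x).elim 0 (ψ : S → ℂ), memℓp_gen' (key ψ)⟩
      map_add' := by
        intro φ ψ
        ext x
        change (f x).elim (0 : ℂ) (⇑(φ + ψ)) = (f x).elim (0 : ℂ) ⇑φ + (f x).elim (0 : ℂ) ⇑ψ
        cases f x
        · exact (add_zero (0 : ℂ)).symm
        · rfl
      map_smul' := by
        intro c ψ
        ext x
        change (f x).elim (0 : ℂ) (⇑(c • ψ)) = c • (f x).elim (0 : ℂ) ⇑ψ
        cases f x <;> simp }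
    1 (by
      intro ψ
      rw [one_mul]
      exact lp.norm_le_of_forall_sum_le (by norm_num) (norm_nonneg _) (key ψ))

theorem pequivOp_apply (f : S ≃. S) (ψ : lp (fun _ : S => ℂ) 2) (x : S) :
    pequivOp f ψ x = (f x).elim 0 (ψ : S → ℂ) := rfl

theorem pequivOp_mul (f g : S ≃. S) : pequivOp f * pequivOp g = pequivOp (f.trans g) := by
  ext ψ x
  change (f x).elim 0 (fun y => (g y).elim 0 (ψ : S → ℂ)) = ((f x).bind g).elim 0 (ψ : S → ℂ)
  cases f x <;> simp

theorem pequivOp_refl : pequivOp (PEquiv.refl S) = 1 := by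
  ext ψ x
  rfl

theorem star_pequivOp (f : S ≃. S) : star (pequivOp f) = pequivOp f.symm := by
  rw [ContinuousLinearMap.star_eq_adjoint]
  symm
  rw [ContinuousLinearMap.eq_adjoint_iff]
  intro φ ψ
  rw [lp.inner_eq_tsum, lp.inner_eq_tsum]
  have h1 : ∀ x : S, f.symm x = none ∨ ∃ y, f.symm x = some y ∧ f y = some x := by
    intro x
    cases h : f.symm x with
    | none => exact Or.inl rfl
    | some y => exact Or.inr ⟨y, rfl, (f.eq_some_iff).1 h⟩
  have h2 : ∀ x y : S, f x = some y → f.symm y = some x := fun x y h => (f.eq_some_iff).2 h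
  simp only [pequivOp_apply]
  refine tsum_eq_tsum_of_ne_zero_bij
    (fun x => ((f x.1).getD x.1)) ?_ ?_ ?_
  · rintro ⟨x, hx⟩ ⟨y, hy⟩ hxy
    simp only [Function.mem_support] at hx hy
    cases hfx : f x with
    | none => simp [hfx] at hx
    | some a =>
      cases hfy : f y with
      | none => simp [hfy] at hy
      | some b =>
        simp only [hfx, hfy, Option.getD_some] at hxy
        subst hxy
        exact Subtype.ext (f.inj hfx hfy)
  · intro x hx
    simp only [Function.mem_support] at hx
    rcases h1 x with h | ⟨y, hy, hfy⟩
    · simp [h] at hx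
    · refine ⟨⟨y, ?_⟩, ?_⟩
      · simp only [Function.mem_support, hfy]
        simpa [hy] using hx
      · simp [hfy]
  · rintro ⟨x, hx⟩
    simp only [Function.mem_support] at hx
    cases hfx : f x with
    | none => simp [hfx] at hx
    | some a => simp [h2 x a hfx]

end PartialTranslation

/-- The configuration that equals `t` on `Λ` and `σ` off `Λ`. -/
def override {d : ℕ} {Λ : Finset ℤ} (σ : Config d) (t : Λ → Fin d) : Config d :=
  fun z => if h : z ∈ Λ then t ⟨z, h⟩ else σ z

theorem restrict_override {d : ℕ} {Λ : Finset ℤ} (σ : Config d) (t : Λ → Fin d) :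
    (fun z : Λ => override σ t z) = t := by
  funext z
  simp [override]

theorem override_override {d : ℕ} {Λ : Finset ℤ} (σ : Config d) (s t : Λ → Fin d) :
    override (override σ s) t = override σ t := by
  funext z
  by_cases h : z ∈ Λ <;> simp [override, h]

theorem override_restrict {d : ℕ} {Λ : Finset ℤ} (σ : Config d) :
    override σ (fun z : Λ => σ z) = σ := by
  funext z
  by_cases h : z ∈ Λ <;> simp [override, h]

/-- The partial bijection of configurations that replaces the pattern `s` on `Λ` by `t`. -/
def replace {d : ℕ} {Λ : Finset ℤ} (s t : Λ → Fin d) : Config d ≃. Config d where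
  toFun σ := if (fun z : Λ => σ z) = s then some (override σ t) else none
  invFun σ := if (fun z : Λ => σ z) = t then some (override σ s) else none
  inv := by
    intro σ τ
    simp only [Option.ite_none_right_eq_some, Option.some.injEq]
    constructor
    · rintro ⟨rfl, rfl⟩
      exact ⟨restrict_override _ _, by rw [override_override, override_restrict]⟩
    · rintro ⟨rfl, rfl⟩
      exact ⟨restrict_override _ _, by rw [override_override, override_restrict]⟩

theorem replace_apply {d : ℕ} {Λ : Finset ℤ} (s t : Λ → Fin d) (σ : Config d) :
    replace s t σ = if (fun z : Λ => σ z) = s then some (override σ t) else none := rfl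

/-- The action of a local observable `a ∈ ⨂_{Λ} M_d(ℂ)` on `ℓ²(ℤ → Fin d)`, that is `a ⊗ 1`. -/
def localOp {d : ℕ} {Λ : Finset ℤ} (a : LocalAlg d Λ) : HilbertSp d →L[ℂ] HilbertSp d :=
  ∑ s : Λ → Fin d, ∑ t : Λ → Fin d, a s t • pequivOp (replace s t)

theorem localOp_apply {d : ℕ} {Λ : Finset ℤ} (a : LocalAlg d Λ) (ψ : HilbertSp d)
    (σ : Config d) :
    localOp a ψ σ = ∑ t : Λ → Fin d, a (fun z => σ z) t * ψ (override σ t) := by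
  have h : ∀ s t : Λ → Fin d, (a s t • pequivOp (replace s t)) ψ σ
      = if (fun z : Λ => σ z) = s then a s t * ψ (override σ t) else 0 := by
    intro s t
    change a s t • (replace s t σ).elim 0 (ψ : Config d → ℂ) = _
    rw [replace_apply]
    split_ifs <;> simp
  simp only [localOp, sum_apply, lp.coeFn_sum, Finset.sum_apply, h]
  rw [Finset.sum_comm]
  simp

/-- The embedding of `⨂_{Λ} M_d(ℂ)` into the bounded operators on `ℓ²(ℤ → Fin d)`. -/
def localRep (d : ℕ) (Λ : Finset ℤ) :
    LocalAlg d Λ →⋆ₐ[ℂ] (HilbertSp d →L[ℂ] HilbertSp d) where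
  toFun := localOp
  map_one' := by
    ext ψ σ
    rw [localOp_apply]
    simp [Matrix.one_apply, override_restrict]
  map_mul' a b := by
    ext ψ σ
    rw [localOp_apply, mul_apply_eq_comp, localOp_apply]
    simp only [localOp_apply, restrict_override, override_override, Matrix.mul_apply,
      Finset.sum_mul, Finset.mul_sum, mul_assoc]
    rw [Finset.sum_comm]
  map_zero' := by simp [localOp]
  map_add' a b := by simp [localOp, add_smul, Finset.sum_add_distrib]
  commutes' c := by
    ext ψ σ
    rw [localOp_apply]
    simp [Matrix.algebraMap_matrix_apply, override_restrict, Algebra.algebraMap_eq_smul_one]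
  map_star' a := by
    have hs : ∀ s t : Λ → Fin d, (replace s t).symm = replace t s := fun s t => rfl
    simp only [localOp, star_sum, star_smul, star_pequivOp, hs, Matrix.star_apply]
    rw [Finset.sum_comm]

/-- The local algebras are represented faithfully. -/
theorem localRep_injective (d : ℕ) [NeZero d] (Λ : Finset ℤ) :
    Function.Injective (localRep d Λ) := by
  classical
  intro a b hab
  ext s t
  have h := congrArg (fun T : HilbertSp d →L[ℂ] HilbertSp d =>
    T (lp.single 2 (override (fun _ => 0) t) (1 : ℂ)) (override (fun _ => 0) s)) hab
  change localOp a _ _ = localOp b _ _ at h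
  have key : ∀ u : Λ → Fin d,
      (lp.single 2 (override (fun _ => 0) t) (1 : ℂ) : HilbertSp d) (override (fun _ => 0) u)
        = if u = t then 1 else 0 := by
    intro u
    rw [lp.coeFn_single, Pi.single_apply]
    congr 1
    refine propext ⟨fun h => ?_, fun h => by rw [h]⟩
    rw [← restrict_override (fun _ => 0) u, h, restrict_override]
  rw [localOp_apply, localOp_apply] at h
  simpa only [restrict_override, override_override, key, mul_ite, mul_one, mul_zero,
    Finset.sum_ite_eq', Finset.mem_univ, if_true] using h

/-- The *-algebra generated by (equivalently, the directed union of) the local algebras. -/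
def localObservables (d : ℕ) : StarSubalgebra ℂ (HilbertSp d →L[ℂ] HilbertSp d) :=
  ⨆ Λ : Finset ℤ, (localRep d Λ).range

/-- The quasi-local algebra `𝒜_ℤ`: the norm closure of the algebra of local observables. -/
def quasiLocal (d : ℕ) : StarSubalgebra ℂ (HilbertSp d →L[ℂ] HilbertSp d) :=
  (localObservables d).topologicalClosure

theorem localRep_mem (d : ℕ) (Λ : Finset ℤ) (a : LocalAlg d Λ) :
    localRep d Λ a ∈ quasiLocal d :=
  StarSubalgebra.le_topologicalClosure _
    ((le_iSup (fun Λ : Finset ℤ => (localRep d Λ).range) Λ) ⟨a, rfl⟩)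

/-- The inclusion of the local algebra of `Λ` into the quasi-local algebra. -/
def localEmbed (d : ℕ) (Λ : Finset ℤ) : LocalAlg d Λ →⋆ₐ[ℂ] quasiLocal d :=
  StarAlgHom.codRestrict (localRep d Λ) (quasiLocal d) (localRep_mem d Λ)

/-- A one-site observable, placed at the site `0`, as an element of the quasi-local algebra. -/
def atOrigin {d : ℕ} (A : Matrix (Fin d) (Fin d) ℂ) : quasiLocal d :=
  localEmbed d {0} (siteMatrix ⟨0, Finset.mem_singleton_self 0⟩ A)

/-! ### Lattice translations -/

/-- Translation of configurations, `σ ↦ σ(· + j)`. -/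
def shiftConfig (d : ℕ) (j : ℤ) : Config d ≃ Config d :=
  Equiv.arrowCongr (Equiv.subRight j) (Equiv.refl _)

theorem shiftConfig_apply (d : ℕ) (j : ℤ) (σ : Config d) (z : ℤ) :
    shiftConfig d j σ z = σ (z + j) := rfl

theorem shiftConfig_symm_apply (d : ℕ) (j : ℤ) (σ : Config d) (z : ℤ) :
    (shiftConfig d j).symm σ z = σ (z - j) := rfl

/-- The unitary `(U_j ψ)(σ) = ψ(σ(· + j))` on `ℓ²(ℤ → Fin d)`. -/
def shiftUnitary (d : ℕ) (j : ℤ) : unitary (HilbertSp d →L[ℂ] HilbertSp d) :=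
  ⟨pequivOp (shiftConfig d j).toPEquiv, by
    constructor
    · rw [star_pequivOp, pequivOp_mul, ← Equiv.toPEquiv_symm, ← Equiv.toPEquiv_trans,
        Equiv.symm_trans_self, Equiv.toPEquiv_refl, pequivOp_refl]
    · rw [star_pequivOp, pequivOp_mul, ← Equiv.toPEquiv_symm, ← Equiv.toPEquiv_trans,
        Equiv.self_trans_symm, Equiv.toPEquiv_refl, pequivOp_refl]⟩

theorem conj_shift_apply (d : ℕ) (j : ℤ) (T : HilbertSp d →L[ℂ] HilbertSp d) (ψ : HilbertSp d)
    (σ : Config d) :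
    Unitary.conjStarAlgAut ℂ _ (shiftUnitary d j) T ψ σ
      = T (pequivOp (shiftConfig d j).symm.toPEquiv ψ) (shiftConfig d j σ) := by
  rw [Unitary.conjStarAlgAut_apply]
  change (pequivOp (shiftConfig d j).toPEquiv * T
    * star (pequivOp (shiftConfig d j).toPEquiv)) ψ σ = _
  rw [star_pequivOp, ← Equiv.toPEquiv_symm]
  rfl

/-- The translate by `j` of an observable in the region `Λ` is an observable in `Λ + j`. -/
theorem conj_shift_localRep (d : ℕ) (j : ℤ) (Λ : Finset ℤ) (a : LocalAlg d Λ) :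
    ∃ (Λ' : Finset ℤ) (b : LocalAlg d Λ'),
      Unitary.conjStarAlgAut ℂ _ (shiftUnitary d j) (localRep d Λ a) = localRep d Λ' b := by
  classical
  let Λ' : Finset ℤ := Λ.map (Equiv.addRight j).toEmbedding
  have hm : ∀ z : ℤ, z ∈ Λ ↔ z + j ∈ Λ' := by
    intro z
    simp [Λ']
  let e : Λ ≃ Λ' := (Equiv.addRight j).subtypeEquiv hm
  let E : (Λ → Fin d) ≃ (Λ' → Fin d) := Equiv.arrowCongr e (Equiv.refl _)
  refine ⟨Λ', a.submatrix E.symm E.symm, ?_⟩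
  ext ψ σ
  rw [conj_shift_apply]
  change localOp a _ _ = localOp (a.submatrix E.symm E.symm) ψ σ
  rw [localOp_apply, localOp_apply, ← E.sum_comp]
  refine Finset.sum_congr rfl fun t _ => ?_
  rw [Matrix.submatrix_apply, Equiv.symm_apply_apply]
  congr 1
  refine congrArg (ψ : Config d → ℂ) (funext fun z => ?_)
  rw [shiftConfig_symm_apply]
  have hz : z - j ∈ Λ ↔ z ∈ Λ' := by rw [hm, sub_add_cancel]
  by_cases h : z ∈ Λ'
  · have h' := hz.2 h
    simp only [override, h, h', dif_pos]
    rfl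
  · have h' : z - j ∉ Λ := fun h1 => h (hz.1 h1)
    simp [override, h, h', shiftConfig_apply]

theorem conj_shift_mem (d : ℕ) (j : ℤ) (T : HilbertSp d →L[ℂ] HilbertSp d)
    (hT : T ∈ quasiLocal d) :
    Unitary.conjStarAlgAut ℂ _ (shiftUnitary d j) T ∈ quasiLocal d := by
  have h1 : localObservables d ≤ (localObservables d).comap
      (Unitary.conjStarAlgAut ℂ _ (shiftUnitary d j)).toStarAlgHom := by
    refine iSup_le fun Λ => ?_
    rintro _ ⟨a, rfl⟩
    obtain ⟨Λ', b, hb⟩ := conj_shift_localRep d j Λ a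
    change Unitary.conjStarAlgAut ℂ _ (shiftUnitary d j) (localRep d Λ a) ∈
      localObservables d
    rw [hb]
    exact (le_iSup (fun Λ : Finset ℤ => (localRep d Λ).range) Λ') ⟨b, rfl⟩
  have hc : Continuous (fun T : HilbertSp d →L[ℂ] HilbertSp d =>
      Unitary.conjStarAlgAut ℂ _ (shiftUnitary d j) T) := by
    simp only [Unitary.conjStarAlgAut_apply]
    fun_prop
  have hT' : T ∈ closure (localObservables d : Set (HilbertSp d →L[ℂ] HilbertSp d)) := hT
  exact map_mem_closure hc hT' (fun x hx => h1 hx)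

/-- The lattice translation `γ_j` of the quasi-local algebra. -/
def translate (d : ℕ) (j : ℤ) : quasiLocal d →⋆ₐ[ℂ] quasiLocal d :=
  StarAlgHom.codRestrict
    ((Unitary.conjStarAlgAut ℂ _ (shiftUnitary d j)).toStarAlgHom.comp (quasiLocal d).subtype)
    (quasiLocal d) (fun x => conj_shift_mem d j x.1 x.2)

/-- `siteMatrix j A` is the translate `γ_j(A)`. -/
theorem localEmbed_siteMatrix {d : ℕ} {Λ : Finset ℤ} (j : Λ) (A : Matrix (Fin d) (Fin d) ℂ) :
    localEmbed d Λ (siteMatrix j A) = translate d j (atOrigin A) := by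
  have key : ∀ (Λ : Finset ℤ) (j : Λ) (ψ : HilbertSp d) (σ : Config d),
      localOp (siteMatrix j A) ψ σ
        = ∑ c : Fin d, A (σ j) c * ψ (Function.update σ (j : ℤ) c) := by
    intro Λ j ψ σ
    rw [localOp_apply]
    symm
    refine Finset.sum_of_injOn (fun c => Function.update (fun z : Λ => σ z) j c) ?_ ?_ ?_ ?_
    · intro c _ c' _ h
      simpa using congrFun h j
    · intro c _
      simp
    · intro t _ ht
      have : ¬ ∀ k : Λ, k ≠ j → σ k = t k := by
        intro hk
        refine ht ⟨t j, by simp, ?_⟩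
        funext k
        by_cases hkj : k = j
        · subst hkj; simp
        · simp [hkj, hk k hkj]
      simp only [siteMatrix, Matrix.of_apply, this, if_false, zero_mul]
    · intro c _
      have h1 : ∀ k : Λ, k ≠ j → σ k = Function.update (fun z : Λ => σ z) j c k := by
        intro k hk
        simp [hk]
      have h2 : override σ (Function.update (fun z : Λ => σ z) j c)
          = Function.update σ (j : ℤ) c := by
        funext z
        by_cases hz : z = j
        · subst hz; simp [override]
        · by_cases hz' : z ∈ Λ
          · have : (⟨z, hz'⟩ : Λ) ≠ j := fun h => hz (congrArg Subtype.val h)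
            simp [override, hz, hz', this]
          · simp [override, hz, hz']
      simp only [siteMatrix, Matrix.of_apply]
      rw [if_pos h1, h2]
      simp
  apply Subtype.ext
  change localOp (siteMatrix j A) = Unitary.conjStarAlgAut ℂ _ (shiftUnitary d j)
    (localOp (siteMatrix (Λ := {0}) ⟨0, Finset.mem_singleton_self 0⟩ A))
  ext ψ σ
  rw [conj_shift_apply, key, key]
  refine Finset.sum_congr rfl fun c _ => ?_
  have h1 : shiftConfig d j σ 0 = σ j := by simp [shiftConfig_apply]
  rw [h1]
  congr 1
  refine congrArg (ψ : Config d → ℂ) (funext fun z => ?_)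
  rw [shiftConfig_symm_apply]
  by_cases hz : z = j
  · subst hz; simp
  · have : z - (j : ℤ) ≠ 0 := sub_ne_zero.2 hz
    simp [hz, this, shiftConfig_apply]

/-! ### Translation invariant states, mean entropy, and the entropy function -/

/-- `ω` is a state: a positive, normalized linear functional. -/
def IsState {d : ℕ} (ω : quasiLocal d →ₗ[ℂ] ℂ) : Prop :=
  ω 1 = 1 ∧ ∀ a : quasiLocal d, 0 ≤ ω (star a * a)

/-- The set `S_γ` of translation invariant states. -/
def invariantStates (d : ℕ) : Set (quasiLocal d →ₗ[ℂ] ℂ) :=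
  {ω | IsState ω ∧ ∀ (j : ℤ) (a : quasiLocal d), ω (translate d j a) = ω a}

/-- The density matrix of the restriction of `ω` to the local algebra of `Λ`. -/
def densityMatrix {d : ℕ} (ω : quasiLocal d →ₗ[ℂ] ℂ) (Λ : Finset ℤ) : LocalAlg d Λ :=
  Matrix.of fun s t => ω (localEmbed d Λ (Matrix.single t s 1))

/-- The density matrix represents the restricted functional: `ω(a) = Tr (ρ a)`. -/
theorem trace_densityMatrix_mul {d : ℕ} (ω : quasiLocal d →ₗ[ℂ] ℂ) (Λ : Finset ℤ)
    (a : LocalAlg d Λ) : (densityMatrix ω Λ * a).trace = ω (localEmbed d Λ a) := by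
  conv_rhs => rw [Matrix.matrix_eq_sum_single a]
  simp only [map_sum, Matrix.trace, Matrix.diag_apply, Matrix.mul_apply, densityMatrix,
    Matrix.of_apply]
  rw [Finset.sum_comm]
  refine Finset.sum_congr rfl fun s _ => Finset.sum_congr rfl fun t _ => ?_
  have : Matrix.single s t (a s t) = a s t • Matrix.single s t (1 : ℂ) := by
    rw [Matrix.smul_single, smul_eq_mul, mul_one]
  rw [this, map_smul, map_smul, smul_eq_mul, mul_comm]

/-- The von Neumann entropy `-Tr (ρ log ρ)` of a density matrix, with `0 log 0 = 0`, through the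
functional calculus of the self-adjoint matrix `ρ` applied to `x ↦ -x log x`. -/
def vonNeumannEntropy {ι : Type*} [Fintype ι] [DecidableEq ι] (ρ : Matrix ι ι ℂ) : ℝ :=
  (cfc Real.negMulLog ρ).trace.re

/-- The mean entropy `s(ω) = lim_n (2 n + 1)⁻¹ S(ω|_{[-n, n]})`. -/
def meanEntropy {d : ℕ} (ω : quasiLocal d →ₗ[ℂ] ℂ) : ℝ :=
  limUnder atTop fun n : ℕ =>
    (2 * (n : ℝ) + 1)⁻¹ * vonNeumannEntropy (densityMatrix ω (box n))

/-- The entropy function `μ : ℝ^m → [-∞, ∞)` of `A_1, …, A_m`: the supremum of the mean entropies of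
the translation invariant states with `ω(A_i) = x_i` for all `i`. It is `-∞` if there is no such
state, as the supremum of the empty set in `EReal` is `⊥`. -/
def entropyFunction {d m : ℕ} (A : Fin m → Matrix (Fin d) (Fin d) ℂ)
    (x : EuclideanSpace ℝ (Fin m)) : EReal :=
  ⨆ ω ∈ {ω ∈ invariantStates d | ∀ i, ω (atOrigin (A i)) = (x i : ℂ)}, (meanEntropy ω : EReal)

/-- The vector `(Tr p H_{1,n} / Tr p, …, Tr p H_{m,n} / Tr p) ∈ ℝ^m`, for a nonzero projection
`p ∈ ⨂_{[-n, n]} M_d(ℂ)`. All the traces are real in that case. -/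
def normalizedExpectation {d m : ℕ} (A : Fin m → Matrix (Fin d) (Fin d) ℂ) (n : ℕ)
    (p : LocalAlg d (box n)) : EuclideanSpace ℝ (Fin m) :=
  WithLp.toLp 2 fun i => ((p * spatialMean n (A i)).trace / p.trace).re

end SpinChain

end

/-! A large projection yields a state of large entropy: the eigenvalues of `p / Tr p` are `0` and `1
/ Tr p`, so its entropy is `log Tr p`. Extend this density matrix to a state of the whole chain
(`projectionState`) and average it over the translations in `[-n, n]`. The average takes on `A_i`
exactly the value of the original state on the spatial mean `H_{i,n}`, and it is translation
invariant up to an error of order `1/n`.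

Fix a real `c` below the limsup and an ultrafilter on the indices, refining `atTop`, along which the
normalized logarithms exceed `c`. The averaged states are bounded by the norm, so they converge
pointwise to a translation invariant state `ω`. Its expectations lie in the closed set `C`. It
remains to prove `c ≤ s(ω)`; then `ω` bounds `c` by the value of `μ` at a point of `C`.

For this, tile `[-n, n]` by intervals of a fixed length `M` in all `M` possible positions.
Subadditivity bounds the box entropy by the block entropies, and concavity moves the mean of the
block entropies onto the averaged state; the ends cost at most `2 M² log d`, which vanishes after
division by `2n + 1` (`mul_entropy_le_averageState`). Upper semicontinuity on the fixed block gives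
`c M ≤ S_{[0,M)}(ω)`, and Fekete's lemma gives `c ≤ s(ω)`.

All the entropy inequalities used on the way rest on one variational principle: the entropy is the
infimum of cross entropies, each linear and continuous in `ρ` (`vonNeumannEntropy_le_crossEntropy`,
`exists_crossEntropy_le`). -/

namespace SpinChain

/-! ### Von Neumann entropy of density matrices -/

section MatrixEntropy

variable {ι κ : Type*} [Fintype ι] [Fintype κ]

/-- The cross entropy `-Tr (ρ log τ)` of `ρ` relative to `τ = U diag(q) U*`. -/
noncomputable def crossEntropy (ρ U : Matrix ι ι ℂ) (q : ι → ℝ) : ℝ :=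
  -∑ i, ((star U * ρ * U) i i).re * Real.log (q i)

/-- A density matrix: positive semidefinite with trace one. -/
def IsDensity (ρ : Matrix ι ι ℂ) : Prop := ρ.PosSemidef ∧ ρ.trace = 1

/-- This is `log x ≤ x - 1` at `x = b / a`, multiplied by `a`; the case `a = 0` relies on `0 * log 0
= 0`. -/
theorem sub_le_mul_log_sub {a b : ℝ} (ha : 0 ≤ a) (hb : 0 < b) :
    a - b ≤ a * Real.log a - a * Real.log b := by
  rcases ha.eq_or_lt with rfl | ha
  · simp [hb.le]
  · have h := Real.log_le_sub_one_of_pos (div_pos hb ha)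
    rw [Real.log_div hb.ne' ha.ne'] at h
    have h2 := mul_le_mul_of_nonneg_left h ha.le
    have h3 : a * (b / a - 1) = b - a := by field_simp
    linarith

/-- The commutative core of Klein's inequality. Sum `sub_le_mul_log_sub` for the pairs `(a i, b j)`
with weights `w i j`: the linear terms collapse to `∑ a - ∑ b ≥ 0`. The weights will be the squared
overlaps of two orthonormal bases. -/
theorem gibbs_of_doublyStochastic {w : ι → ι → ℝ} (hw : ∀ i j, 0 ≤ w i j)
    (hrow : ∀ i, ∑ j, w i j = 1) (hcol : ∀ j, ∑ i, w i j = 1) {a b : ι → ℝ}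
    (ha : ∀ i, 0 ≤ a i) (hb : ∀ j, 0 < b j) (hab : ∑ j, b j ≤ ∑ i, a i) :
    ∑ j, (∑ i, w i j * a i) * Real.log (b j) ≤ ∑ i, a i * Real.log (a i) := by
  have h1 : ∑ i, ∑ j, w i j * (a i - b j)
      ≤ ∑ i, ∑ j, w i j * (a i * Real.log (a i) - a i * Real.log (b j)) :=
    Finset.sum_le_sum fun i _ => Finset.sum_le_sum fun j _ =>
      mul_le_mul_of_nonneg_left (sub_le_mul_log_sub (ha i) (hb j)) (hw i j)
  have e (f : ι → ℝ) : ∑ i, ∑ j, w i j * f i = ∑ i, f i :=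
    Finset.sum_congr rfl fun i _ => by rw [← Finset.sum_mul, hrow, one_mul]
  have e' : ∑ i, ∑ j, w i j * b j = ∑ j, b j := by
    rw [Finset.sum_comm]
    exact Finset.sum_congr rfl fun i _ => by rw [← Finset.sum_mul, hcol, one_mul]
  have e'' : ∑ i, ∑ j, w i j * (a i * Real.log (b j))
      = ∑ j, (∑ i, w i j * a i) * Real.log (b j) := by
    rw [Finset.sum_comm]
    simp only [Finset.sum_mul, mul_assoc]
  simp only [mul_sub, Finset.sum_sub_distrib, e, e', e''] at h1
  linarith

theorem crossEntropy_sum_smul {α : Type*} (s : Finset α) (c : α → ℝ) (ρ : α → Matrix ι ι ℂ)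
    (U : Matrix ι ι ℂ) (q : ι → ℝ) :
    crossEntropy (∑ x ∈ s, (c x : ℂ) • ρ x) U q = ∑ x ∈ s, c x * crossEntropy (ρ x) U q := by
  simp only [crossEntropy, Finset.mul_sum, Finset.sum_mul, Matrix.sum_apply, Complex.re_sum,
    mul_neg, Finset.sum_neg_distrib, Matrix.mul_smul, Matrix.smul_mul, Matrix.smul_apply,
    smul_eq_mul, Complex.re_ofReal_mul, mul_assoc]
  rw [Finset.sum_comm]

theorem IsDensity.submatrix {ρ : Matrix ι ι ℂ} (hρ : IsDensity ρ) (e : κ ≃ ι) :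
    IsDensity (ρ.submatrix e e) := by
  refine ⟨hρ.1.submatrix e, ?_⟩
  rw [← hρ.2]
  exact e.sum_comp fun i => ρ i i

variable [DecidableEq ι] [DecidableEq κ]

theorem vonNeumannEntropy_eq_sum {ρ : Matrix ι ι ℂ} (hρ : ρ.IsHermitian) :
    vonNeumannEntropy ρ = ∑ i, Real.negMulLog (hρ.eigenvalues i) := by
  rw [vonNeumannEntropy, hρ.cfc_eq, Matrix.IsHermitian.cfc, Unitary.conjStarAlgAut_apply,
    Matrix.trace_mul_comm, ← mul_assoc]
  simp [Matrix.trace]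

theorem IsDensity.sum_eigenvalues {ρ : Matrix ι ι ℂ} (hρ : IsDensity ρ) :
    ∑ i, hρ.1.isHermitian.eigenvalues i = 1 := by
  have h := hρ.1.isHermitian.trace_eq_sum_eigenvalues.symm.trans hρ.2
  simpa using congrArg Complex.re h

theorem vonNeumannEntropy_nonneg {ρ : Matrix ι ι ℂ} (hρ : IsDensity ρ) :
    0 ≤ vonNeumannEntropy ρ := by
  rw [vonNeumannEntropy_eq_sum hρ.1.isHermitian]
  refine Finset.sum_nonneg fun i _ => Real.negMulLog_nonneg (hρ.1.eigenvalues_nonneg i) ?_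
  rw [← hρ.sum_eigenvalues]
  exact Finset.single_le_sum (fun j _ => hρ.1.eigenvalues_nonneg j) (Finset.mem_univ i)

/-- Klein's inequality. -/
theorem vonNeumannEntropy_le_crossEntropy {ρ U : Matrix ι ι ℂ} {q : ι → ℝ} (hρ : IsDensity ρ)
    (hU : U ∈ unitary (Matrix ι ι ℂ)) (hq : ∀ i, 0 < q i) (hq1 : ∑ i, q i ≤ 1) :
    vonNeumannEntropy ρ ≤ crossEntropy ρ U q := by
  have hH := hρ.1.isHermitian
  set a := hH.eigenvalues with ha
  -- `W` is the transition matrix between the eigenbasis of `ρ` and the columns of `U`; its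
  -- unitarity makes `‖W i j‖ ^ 2` doubly stochastic.
  set W : Matrix ι ι ℂ := star (hH.eigenvectorUnitary : Matrix ι ι ℂ) * U with hW
  have hWu : W ∈ unitary (Matrix ι ι ℂ) :=
    mul_mem (Unitary.star_mem hH.eigenvectorUnitary.2) hU
  have hdiag : star U * ρ * U = star W * Matrix.diagonal (fun i => (a i : ℂ)) * W := by
    conv_lhs => rw [hH.spectral_theorem, Unitary.conjStarAlgAut_apply]
    simp only [hW, star_mul, star_star, mul_assoc]
    rfl
  have hsq (i j : ι) : star (W i j) * W i j = ((‖W i j‖ ^ 2 : ℝ) : ℂ) := by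
    rw [Complex.star_def, Complex.conj_mul']; norm_cast
  have hentry (j : ι) : ((star U * ρ * U) j j).re = ∑ i, ‖W i j‖ ^ 2 * a i := by
    have : (star U * ρ * U) j j = ((∑ i, ‖W i j‖ ^ 2 * a i : ℝ) : ℂ) := by
      rw [hdiag, Matrix.mul_apply]
      push_cast
      refine Finset.sum_congr rfl fun i _ => ?_
      rw [Matrix.mul_diagonal, Matrix.star_apply, mul_right_comm, hsq]
      push_cast; rfl
    rw [this, Complex.ofReal_re]
  have hcol (j : ι) : ∑ i, ‖W i j‖ ^ 2 = 1 := by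
    have h := Matrix.ext_iff.2 (Unitary.star_mul_self_of_mem hWu) j j
    simp only [Matrix.mul_apply, Matrix.star_apply, hsq, Matrix.one_apply_eq] at h
    exact_mod_cast h
  have hrow (i : ι) : ∑ j, ‖W i j‖ ^ 2 = 1 := by
    have h := Matrix.ext_iff.2 (Unitary.mul_star_self_of_mem hWu) i i
    simp only [Matrix.mul_apply, Matrix.star_apply, mul_comm (W i _), hsq,
      Matrix.one_apply_eq] at h
    exact_mod_cast h
  have h := gibbs_of_doublyStochastic (fun i j => sq_nonneg ‖W i j‖) hrow hcol
    (fun i => hρ.1.eigenvalues_nonneg i) hq (by rw [hρ.sum_eigenvalues]; exact hq1)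
  rw [vonNeumannEntropy_eq_sum hH, crossEntropy]
  simp only [hentry, Real.negMulLog, neg_mul, Finset.sum_neg_distrib]
  exact neg_le_neg h

/-- Near-optimality in Klein's inequality. With exact eigenvalues as weights the two sides would
agree, but zero eigenvalues are excluded by the strict positivity asked there; mixing in a little of
the uniform distribution restores positivity. -/
theorem exists_crossEntropy_le {ρ : Matrix ι ι ℂ} (hρ : IsDensity ρ) {ε : ℝ} (hε : 0 < ε) :
    ∃ U ∈ unitary (Matrix ι ι ℂ), ∃ q : ι → ℝ, (∀ i, 0 < q i) ∧ ∑ i, q i = 1 ∧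
      crossEntropy ρ U q ≤ vonNeumannEntropy ρ + ε := by
  have hH := hρ.1.isHermitian
  set a := hH.eigenvalues with ha
  have ha0 (i : ι) : 0 ≤ a i := hρ.1.eigenvalues_nonneg i
  have hsum : ∑ i, a i = 1 := hρ.sum_eigenvalues
  set D : ℝ := (Fintype.card ι : ℝ) with hDdef
  have hD : 0 ≤ D := Nat.cast_nonneg _
  -- Normalizing the shifted weights costs `log (1 + D δ) ≤ D δ ≤ ε`; the `+ 1` avoids dividing by
  -- zero.
  set δ : ℝ := ε / (D + 1) with hδ
  have hδ0 : 0 < δ := by positivity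
  have hDδ : D * δ ≤ ε := by
    rw [hδ, mul_div_assoc', div_le_iff₀ (by positivity)]
    nlinarith
  have hden : 0 < 1 + D * δ := by positivity
  have hnum (i : ι) : 0 < a i + δ := by linarith [ha0 i]
  refine ⟨hH.eigenvectorUnitary, hH.eigenvectorUnitary.2, fun i => (a i + δ) / (1 + D * δ),
    fun i => div_pos (hnum i) hden, ?_, ?_⟩
  · rw [← Finset.sum_div, Finset.sum_add_distrib, hsum]
    simp only [Finset.sum_const, Finset.card_univ, nsmul_eq_mul]
    exact div_self hden.ne'
  · have hentry (i : ι) : ((star (hH.eigenvectorUnitary : Matrix ι ι ℂ) * ρ *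
        hH.eigenvectorUnitary) i i).re = a i := by
      have h := hH.conjStarAlgAut_star_eigenvectorUnitary
      rw [Unitary.conjStarAlgAut_apply] at h
      simp only [Unitary.coe_star, star_star] at h
      rw [h]
      simp [ha]
    rw [crossEntropy, vonNeumannEntropy_eq_sum hH]
    simp only [hentry]
    have hlog : Real.log (1 + D * δ) ≤ ε := by
      have := Real.log_le_sub_one_of_pos hden
      linarith
    have hterm (i : ι) : -(a i * Real.log ((a i + δ) / (1 + D * δ)))
        ≤ Real.negMulLog (a i) + a i * ε := by
      rw [Real.log_div (hnum i).ne' hden.ne', Real.negMulLog]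
      rcases (ha0 i).eq_or_lt with h | h
      · simp [← h]
      · have h1 : Real.log (a i) ≤ Real.log (a i + δ) := Real.log_le_log h (by linarith)
        nlinarith
    rw [← Finset.sum_neg_distrib]
    refine (Finset.sum_le_sum fun i _ => hterm i).trans_eq ?_
    rw [Finset.sum_add_distrib, ← Finset.sum_mul, hsum, one_mul]

/-- Klein's inequality against the maximally mixed state. -/
theorem vonNeumannEntropy_le_log_card {ρ : Matrix ι ι ℂ} (hρ : IsDensity ρ) :
    vonNeumannEntropy ρ ≤ Real.log (Fintype.card ι) := by
  rcases isEmpty_or_nonempty ι with h | h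
  · simpa [Matrix.trace] using hρ.2
  have hc : (0 : ℝ) < Fintype.card ι := by exact_mod_cast Fintype.card_pos
  refine (vonNeumannEntropy_le_crossEntropy hρ (one_mem _) (q := fun _ => (Fintype.card ι : ℝ)⁻¹)
    (fun _ => inv_pos.2 hc) ?_).trans_eq ?_
  · simp [hc.ne']
  · have h1 : ∑ i, (ρ i i).re = 1 := by
      have := congrArg Complex.re hρ.2
      simpa [Matrix.trace] using this
    simp [crossEntropy, ← Finset.sum_mul, h1]

/-- Concavity of the entropy. -/
theorem sum_vonNeumannEntropy_le {α : Type*} {s : Finset α} {c : α → ℝ} (hc : ∀ x ∈ s, 0 ≤ c x)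
    {ρ : α → Matrix ι ι ℂ} (hρ : ∀ x ∈ s, IsDensity (ρ x))
    (hρs : IsDensity (∑ x ∈ s, (c x : ℂ) • ρ x)) :
    ∑ x ∈ s, c x * vonNeumannEntropy (ρ x) ≤ vonNeumannEntropy (∑ x ∈ s, (c x : ℂ) • ρ x) := by
  refine le_of_forall_pos_le_add fun ε hε => ?_
  obtain ⟨U, hU, q, hq, hq1, h⟩ := exists_crossEntropy_le hρs hε
  refine le_trans ?_ h
  rw [crossEntropy_sum_smul]
  exact Finset.sum_le_sum fun x hx => mul_le_mul_of_nonneg_left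
    (vonNeumannEntropy_le_crossEntropy (hρ x hx) hU hq hq1.le) (hc x hx)

/-- Upper semicontinuity of the entropy. -/
theorem eventually_vonNeumannEntropy_le {α : Type*} {l : Filter α} {ρ : α → Matrix ι ι ℂ}
    {σ : Matrix ι ι ℂ} (hρ : ∀ᶠ x in l, IsDensity (ρ x)) (hσ : IsDensity σ)
    (h : Tendsto ρ l (𝓝 σ)) {ε : ℝ} (hε : 0 < ε) :
    ∀ᶠ x in l, vonNeumannEntropy (ρ x) ≤ vonNeumannEntropy σ + ε := by
  obtain ⟨U, hU, q, hq, hq1, hX⟩ := exists_crossEntropy_le hσ (half_pos hε)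
  have hcont : Continuous fun ρ : Matrix ι ι ℂ => crossEntropy ρ U q := by
    unfold crossEntropy
    refine (continuous_finsetSum _ fun i _ => ?_).neg
    refine Continuous.mul (Complex.continuous_re.comp ?_) continuous_const
    exact ((continuous_const.matrix_mul continuous_id).matrix_mul continuous_const).matrix_elem i i
  filter_upwards [hρ, ((hcont.tendsto σ).comp h).eventually_lt_const
    (show crossEntropy σ U q < vonNeumannEntropy σ + ε by linarith)] with x hρx hx
  exact (vonNeumannEntropy_le_crossEntropy hρx hU hq hq1.le).trans hx.le

/-- A nearly optimal pair `(U, q)` for `ρ` can be relabelled along `e` without changing its cross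
entropy. Applying this to `e.symm` as well yields equality. -/
theorem vonNeumannEntropy_submatrix_le {ρ : Matrix ι ι ℂ} (hρ : IsDensity ρ) (e : κ ≃ ι) :
    vonNeumannEntropy (ρ.submatrix e e) ≤ vonNeumannEntropy ρ := by
  refine le_of_forall_pos_le_add fun ε hε => ?_
  obtain ⟨U, hU, q, hq, hq1, h⟩ := exists_crossEntropy_le hρ hε
  have hstar : star (U.submatrix e e) = (star U).submatrix e e := rfl
  refine (vonNeumannEntropy_le_crossEntropy (hρ.submatrix e) (U := U.submatrix e e)
    (q := q ∘ e) ?_ (fun i => hq _) ?_).trans (le_trans (le_of_eq ?_) h)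
  · rw [Unitary.mem_iff, hstar, Matrix.submatrix_mul_equiv, Matrix.submatrix_mul_equiv,
      Unitary.star_mul_self_of_mem hU, Unitary.mul_star_self_of_mem hU,
      Matrix.submatrix_one_equiv]
    exact ⟨rfl, rfl⟩
  · rw [← hq1]
    exact (e.sum_comp q).le
  · rw [crossEntropy, crossEntropy, hstar, Matrix.submatrix_mul_equiv, Matrix.submatrix_mul_equiv,
      ← e.sum_comp]
    rfl

theorem vonNeumannEntropy_submatrix {ρ : Matrix ι ι ℂ} (hρ : IsDensity ρ) (e : κ ≃ ι) :
    vonNeumannEntropy (ρ.submatrix e e) = vonNeumannEntropy ρ := by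
  refine (vonNeumannEntropy_submatrix_le hρ e).antisymm ?_
  simpa using vonNeumannEntropy_submatrix_le (hρ.submatrix e) e.symm

open scoped Kronecker in
/-- Subadditivity of the entropy. -/
theorem vonNeumannEntropy_le_add {ρ : Matrix (ι × κ) (ι × κ) ℂ} {σ : Matrix ι ι ℂ}
    {τ : Matrix κ κ ℂ} (hρ : IsDensity ρ) (hσ : IsDensity σ) (hτ : IsDensity τ)
    (hρσ : ∀ i i', ∑ j, ρ (i, j) (i', j) = σ i i')
    (hρτ : ∀ j j', ∑ i, ρ (i, j) (i, j') = τ j j') :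
    vonNeumannEntropy ρ ≤ vonNeumannEntropy σ + vonNeumannEntropy τ := by
  refine le_of_forall_pos_le_add fun ε hε => ?_
  obtain ⟨U, hU, q, hq, hq1, h⟩ := exists_crossEntropy_le hσ (half_pos hε)
  obtain ⟨V, hV, r, hr, hr1, h'⟩ := exists_crossEntropy_le hτ (half_pos hε)
  have hstar : star (U ⊗ₖ V) = star U ⊗ₖ star V := Matrix.conjTranspose_kronecker U V
  have hUV : U ⊗ₖ V ∈ unitary (Matrix (ι × κ) (ι × κ) ℂ) := 
    Matrix.kronecker_mem_unitary hU hV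
  -- Compare `ρ` with the product of near-optimal references for its marginals; the logarithm of the
  -- product weights then splits.
  have hle := vonNeumannEntropy_le_crossEntropy hρ hUV (q := fun x => q x.1 * r x.2)
    (fun x => mul_pos (hq _) (hr _)) (by
      rw [Fintype.sum_prod_type]
      simp only [← Finset.mul_sum, hr1, mul_one, hq1, le_refl])
  have hUrow (b b' : ι) : ∑ i, U b i * star (U b' i) = if b = b' then 1 else 0 := by
    have := Matrix.ext_iff.2 (Unitary.mul_star_self_of_mem hU) b b'
    simpa only [Matrix.mul_apply, Matrix.star_apply, Matrix.one_apply] using this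
  have hVrow (b b' : κ) : ∑ i, V b i * star (V b' i) = if b = b' then 1 else 0 := by
    have := Matrix.ext_iff.2 (Unitary.mul_star_self_of_mem hV) b b'
    simpa only [Matrix.mul_apply, Matrix.star_apply, Matrix.one_apply] using this
  have hexp (i : ι) (j : κ) : (star (U ⊗ₖ V) * ρ * (U ⊗ₖ V)) (i, j) (i, j) =
      ∑ b', ∑ c', ∑ b, ∑ c, (star (U b i) * U b' i) * (star (V c j) * V c' j) *
        ρ (b, c) (b', c') := by
    simp only [Matrix.mul_apply, Fintype.sum_prod_type, Finset.sum_mul, hstar,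
      Matrix.kronecker_apply, Matrix.star_apply]
    refine Finset.sum_congr rfl fun _ _ => Finset.sum_congr rfl fun _ _ =>
      Finset.sum_congr rfl fun _ _ => Finset.sum_congr rfl fun _ _ => by ring
  have h1 (i : ι) : ∑ j, (star (U ⊗ₖ V) * ρ * (U ⊗ₖ V)) (i, j) (i, j)
      = (star U * σ * U) i i := by
    -- Moving the sum over `j` innermost lets the unitarity of `V` force `c = c'`, which leaves the
    -- partial trace of `ρ`.
    have : ∑ j, (star (U ⊗ₖ V) * ρ * (U ⊗ₖ V)) (i, j) (i, j) = ∑ b', ∑ c', ∑ b, ∑ c,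
        star (U b i) * U b' i * ρ (b, c) (b', c') * ∑ j, V c' j * star (V c j) := by
      simp only [hexp, Finset.mul_sum]
      rw [Finset.sum_comm]
      refine Finset.sum_congr rfl fun b' _ => ?_
      rw [Finset.sum_comm]
      refine Finset.sum_congr rfl fun c' _ => ?_
      rw [Finset.sum_comm]
      refine Finset.sum_congr rfl fun b _ => ?_
      rw [Finset.sum_comm]
      exact Finset.sum_congr rfl fun c _ => Finset.sum_congr rfl fun j _ => by ring
    rw [this]
    simp only [hVrow, mul_ite, mul_one, mul_zero, Finset.sum_ite_eq, Finset.mem_univ, if_true,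
      Matrix.mul_apply, Finset.sum_mul, Matrix.star_apply, ← hρσ, Finset.mul_sum]
    refine Finset.sum_congr rfl fun b' _ => ?_
    rw [Finset.sum_comm]
    exact Finset.sum_congr rfl fun b _ => Finset.sum_congr rfl fun c _ => by ring
  have h2 (j : κ) : ∑ i, (star (U ⊗ₖ V) * ρ * (U ⊗ₖ V)) (i, j) (i, j)
      = (star V * τ * V) j j := by
    have : ∑ i, (star (U ⊗ₖ V) * ρ * (U ⊗ₖ V)) (i, j) (i, j) = ∑ b', ∑ c', ∑ c, ∑ b,
        star (V c j) * V c' j * ρ (b, c) (b', c') * ∑ i, U b' i * star (U b i) := by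
      simp only [hexp, Finset.mul_sum]
      rw [Finset.sum_comm]
      refine Finset.sum_congr rfl fun b' _ => ?_
      rw [Finset.sum_comm]
      refine Finset.sum_congr rfl fun c' _ => ?_
      rw [Finset.sum_comm, Finset.sum_comm (γ := κ)]
      refine Finset.sum_congr rfl fun b _ => ?_
      rw [Finset.sum_comm]
      exact Finset.sum_congr rfl fun c _ => Finset.sum_congr rfl fun j _ => by ring
    rw [this]
    simp only [hUrow, mul_ite, mul_one, mul_zero, Finset.sum_ite_eq, Finset.mem_univ, if_true,
      Matrix.mul_apply, Finset.sum_mul, Matrix.star_apply, ← hρτ, Finset.mul_sum]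
    rw [Finset.sum_comm]
    refine Finset.sum_congr rfl fun c' _ => ?_
    rw [Finset.sum_comm]
    exact Finset.sum_congr rfl fun c _ => Finset.sum_congr rfl fun b _ => by ring
  have hsplit : crossEntropy ρ (U ⊗ₖ V) (fun x => q x.1 * r x.2)
      = crossEntropy σ U q + crossEntropy τ V r := by
    have hl (i : ι) (j : κ) : Real.log (q i * r j) = Real.log (q i) + Real.log (r j) :=
      Real.log_mul (hq i).ne' (hr j).ne'
    simp only [crossEntropy, Fintype.sum_prod_type, hl, mul_add, Finset.sum_add_distrib, neg_add,
      ← h1, ← h2, Complex.re_sum, Finset.sum_mul]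
    congr 2
    exact Finset.sum_comm
  linarith

end MatrixEntropy

/-! ### Entropies of the finite-volume restrictions of a state -/

section RegionEntropy

variable {d : ℕ} {ω : quasiLocal d →ₗ[ℂ] ℂ}

theorem localOp_single (Λ : Finset ℤ) (s t : Λ → Fin d) (ψ : HilbertSp d) (σ : Config d) :
    localOp (Matrix.single s t 1) ψ σ
      = if (fun z : Λ => σ z) = s then ψ (override σ t) else 0 := by
  classical
  simp [localOp_apply, Matrix.single_apply, ite_and, eq_comm]

theorem localEmbed_apply (Λ : Finset ℤ) (a : LocalAlg d Λ) :
    (localEmbed d Λ a : HilbertSp d →L[ℂ] HilbertSp d) = localOp a := rfl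

theorem isDensity_densityMatrix (hω : IsState ω) (Λ : Finset ℤ) :
    IsDensity (densityMatrix ω Λ) := by
  refine ⟨?_, ?_⟩
  · have key (x : (Λ → Fin d) → ℂ) : 0 ≤ star x ⬝ᵥ (densityMatrix ω Λ).mulVec x := by
      have hx : star x ⬝ᵥ (densityMatrix ω Λ).mulVec x
          = (densityMatrix ω Λ * Matrix.vecMulVec x (star x)).trace := by
        simp only [dotProduct, Matrix.mulVec, Matrix.trace, Matrix.diag_apply, Matrix.mul_apply,
          Matrix.vecMulVec_apply, Finset.mul_sum]
        exact Finset.sum_congr rfl fun i _ => Finset.sum_congr rfl fun j _ => by ring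
      rw [hx]
      rcases isEmpty_or_nonempty (Λ → Fin d) with h | ⟨⟨s₀⟩⟩
      · simp [Matrix.trace]
      -- A single nonzero row `x*` exhibits the rank-one matrix `x x*` as `b* b`, so positivity of
      -- `ω` applies.
      · set b : LocalAlg d Λ := Matrix.of fun s t => if s = s₀ then star (x t) else 0 with hb
        have : Matrix.vecMulVec x (star x) = star b * b := by
          ext s t
          simp [hb, Matrix.vecMulVec_apply, Matrix.mul_apply, Matrix.star_apply]
        rw [this, trace_densityMatrix_mul, map_mul, map_star]
        exact hω.2 _
    refine .of_dotProduct_mulVec_nonneg ?_ key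
    -- Over `ℂ`, a quadratic form with real values already forces the matrix to be Hermitian.
    rw [← Matrix.isSymmetric_toEuclideanLin_iff, LinearMap.isSymmetric_iff_inner_map_self_real]
    intro v
    have hv : ⟪v, Matrix.toEuclideanLin (densityMatrix ω Λ) v⟫_ℂ
        = star v.ofLp ⬝ᵥ (densityMatrix ω Λ).mulVec v.ofLp := by
      rw [EuclideanSpace.inner_eq_star_dotProduct, dotProduct_comm]
      rfl
    have hr : starRingEnd ℂ ⟪v, Matrix.toEuclideanLin (densityMatrix ω Λ) v⟫_ℂ
        = ⟪v, Matrix.toEuclideanLin (densityMatrix ω Λ) v⟫_ℂ := by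
      rw [hv, Complex.conj_eq_iff_im]
      exact (Complex.nonneg_iff.1 (key v.ofLp)).2.symm
    rw [inner_conj_symm, ← hr, inner_conj_symm]
  · have h := trace_densityMatrix_mul ω Λ 1
    rwa [mul_one, map_one, hω.1] at h

theorem densityMatrix_sum_smul {α : Type*} (s : Finset α) (c : α → ℂ)
    (φ : α → quasiLocal d →ₗ[ℂ] ℂ) (Λ : Finset ℤ) :
    densityMatrix (∑ x ∈ s, c x • φ x) Λ = ∑ x ∈ s, c x • densityMatrix (φ x) Λ := by
  ext i j
  simp [densityMatrix, Matrix.sum_apply, LinearMap.sum_apply]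

/-- Configurations on a disjoint union of regions. -/
def glueEquiv (d : ℕ) {Λ₁ Λ₂ Λ : Finset ℤ} (hd : Disjoint Λ₁ Λ₂)
    (hu : ∀ z, z ∈ Λ ↔ z ∈ Λ₁ ∨ z ∈ Λ₂) :
    (Λ₁ → Fin d) × (Λ₂ → Fin d) ≃ (Λ → Fin d) where
  toFun u z := if h : (z : ℤ) ∈ Λ₁ then u.1 ⟨z, h⟩ else u.2 ⟨z, ((hu z).1 z.2).resolve_left h⟩
  invFun v := (fun z => v ⟨z, (hu z).2 (Or.inl z.2)⟩, fun z => v ⟨z, (hu z).2 (Or.inr z.2)⟩)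
  left_inv u := by
    refine Prod.ext (funext fun z => ?_) (funext fun z => ?_)
    · simp
    · simp [Finset.disjoint_right.1 hd z.2]
  right_inv v := by
    funext z
    by_cases h : (z : ℤ) ∈ Λ₁ <;> simp [h]

/-- Restricting a state is taking a partial trace: summing the matrix units over `j` gives a matrix
unit on `Λ₁` tensored with the identity on `Λ₂`. The equivalence `e` is left abstract so that
swapping the factors gives the other marginal. -/
theorem sum_densityMatrix_glue {Λ₁ Λ₂ Λ : Finset ℤ}
    (hu : ∀ z, z ∈ Λ ↔ z ∈ Λ₁ ∨ z ∈ Λ₂)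
    (e : (Λ₁ → Fin d) × (Λ₂ → Fin d) ≃ (Λ → Fin d))
    (he : ∀ σ : Config d, e.symm (fun z => σ z) = (fun z : Λ₁ => σ z, fun z : Λ₂ => σ z))
    (i i' : Λ₁ → Fin d) :
    ∑ j, densityMatrix ω Λ (e (i, j)) (e (i', j)) = densityMatrix ω Λ₁ i i' := by
  classical
  simp only [densityMatrix, Matrix.of_apply, ← map_sum]
  congr 1
  apply Subtype.ext
  rw [localEmbed_apply, localEmbed_apply]
  ext ψ σ
  have h1 : localOp (∑ j, Matrix.single (e (i', j)) (e (i, j)) (1 : ℂ)) ψ σ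
      = ∑ j, localOp (Matrix.single (e (i', j)) (e (i, j)) (1 : ℂ)) ψ σ := by
    have : localOp (∑ j, Matrix.single (e (i', j)) (e (i, j)) (1 : ℂ))
      = ∑ j, localOp (Matrix.single (e (i', j)) (e (i, j)) (1 : ℂ)) := map_sum (localRep d Λ) _ _
    rw [this, sum_apply, lp.coeFn_sum, Finset.sum_apply]
  have h2 (j : Λ₂ → Fin d) : (fun z : Λ => σ z) = e (i', j) ↔
      (fun z : Λ₁ => σ z) = i' ∧ j = (fun z : Λ₂ => σ z) := by
    rw [← Equiv.symm_apply_eq, he, Prod.mk.injEq, eq_comm (a := j)]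
  -- On `Λ₂` the configuration is overwritten by its own values.
  have h3 : override σ (e (i, fun z : Λ₂ => σ z)) = override σ i := by
    set τ := override σ (e (i, fun z : Λ₂ => σ z)) with hτ
    have hr : e.symm (fun z => τ z) = (i, fun z : Λ₂ => σ z) := by
      rw [Equiv.symm_apply_eq]
      exact restrict_override σ _
    rw [he, Prod.mk.injEq] at hr
    funext z
    by_cases hz1 : z ∈ Λ₁
    · rw [show τ z = i ⟨z, hz1⟩ from congrFun hr.1 ⟨z, hz1⟩]
      simp [override, hz1]
    · rw [show override σ i z = σ z by simp [override, hz1]]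
      by_cases hz2 : z ∈ Λ₂
      · exact congrFun hr.2 ⟨z, hz2⟩
      · have : z ∉ Λ := fun h => ((hu z).1 h).elim hz1 hz2
        simp [hτ, override, this]
  rw [h1]
  simp only [localOp_single, h2, ite_and]
  by_cases h : (fun z : Λ₁ => σ z) = i' <;> simp [h, h3]

theorem vonNeumannEntropy_densityMatrix_le_add (hω : IsState ω) {Λ₁ Λ₂ Λ : Finset ℤ}
    (hd : Disjoint Λ₁ Λ₂) (hu : ∀ z, z ∈ Λ ↔ z ∈ Λ₁ ∨ z ∈ Λ₂) :
    vonNeumannEntropy (densityMatrix ω Λ) ≤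
      vonNeumannEntropy (densityMatrix ω Λ₁) + vonNeumannEntropy (densityMatrix ω Λ₂) := by
  classical
  have hρ := isDensity_densityMatrix hω Λ
  rw [← vonNeumannEntropy_submatrix hρ (glueEquiv d hd hu)]
  refine vonNeumannEntropy_le_add (hρ.submatrix _) (isDensity_densityMatrix hω Λ₁)
    (isDensity_densityMatrix hω Λ₂) (fun i i' => ?_) (fun j j' => ?_)
  · exact sum_densityMatrix_glue hu (glueEquiv d hd hu) (fun σ => rfl) i i'
  · exact sum_densityMatrix_glue (fun z => (hu z).trans or_comm)
      ((Equiv.prodComm _ _).trans (glueEquiv d hd hu)) (fun σ => rfl) j j'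

/-- The functional `a ↦ ω(γ_j(a))`. -/
noncomputable def shiftFunctional (ω : quasiLocal d →ₗ[ℂ] ℂ) (j : ℤ) : quasiLocal d →ₗ[ℂ] ℂ :=
  ω ∘ₗ (translate d j).toAlgHom.toLinearMap

theorem shiftFunctional_apply (ω : quasiLocal d →ₗ[ℂ] ℂ) (j : ℤ) (a : quasiLocal d) :
    shiftFunctional ω j a = ω (translate d j a) := rfl

theorem IsState.shiftFunctional (hω : IsState ω) (j : ℤ) : IsState (shiftFunctional ω j) := by
  refine ⟨?_, fun a => ?_⟩
  · rw [shiftFunctional_apply, map_one, hω.1]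
  · rw [shiftFunctional_apply, map_mul, map_star]
    exact hω.2 _

theorem translate_add (i j : ℤ) (a : quasiLocal d) :
    translate d (i + j) a = translate d i (translate d j a) := by
  apply Subtype.ext
  change Unitary.conjStarAlgAut ℂ _ (shiftUnitary d (i + j)) (a : HilbertSp d →L[ℂ] HilbertSp d)
    = Unitary.conjStarAlgAut ℂ _ (shiftUnitary d i)
      (Unitary.conjStarAlgAut ℂ _ (shiftUnitary d j) (a : HilbertSp d →L[ℂ] HilbertSp d))
  ext ψ σ
  rw [conj_shift_apply, conj_shift_apply, conj_shift_apply]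
  have h1 : pequivOp (shiftConfig d (i + j)).symm.toPEquiv ψ =
      pequivOp (shiftConfig d j).symm.toPEquiv (pequivOp (shiftConfig d i).symm.toPEquiv ψ) := by
    refine lp.ext (funext fun τ => ?_)
    change ψ ((shiftConfig d (i + j)).symm τ) =
      ψ ((shiftConfig d i).symm ((shiftConfig d j).symm τ))
    refine congrArg (ψ : Config d → ℂ) (funext fun z => ?_)
    simp only [shiftConfig_symm_apply]
    congr 1; ring
  have h2 : shiftConfig d (i + j) σ = shiftConfig d j (shiftConfig d i σ) := by
    funext z
    simp only [shiftConfig_apply]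
    congr 1; ring
  rw [h1, h2]

/-- Translation carries matrix units on `Λ` to matrix units on `Λ + j`, so the two density matrices
differ only by relabelling configurations. -/
theorem vonNeumannEntropy_shiftFunctional (hω : IsState ω) (j : ℤ) (Λ : Finset ℤ) :
    vonNeumannEntropy (densityMatrix (shiftFunctional ω j) Λ) =
      vonNeumannEntropy (densityMatrix ω (Λ.map (Equiv.addRight j).toEmbedding)) := by
  classical
  set Λ' : Finset ℤ := Λ.map (Equiv.addRight j).toEmbedding with hΛ'
  have hm : ∀ z : ℤ, z ∈ Λ ↔ z + j ∈ Λ' := by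
    intro z
    simp [Λ']
  let e : Λ ≃ Λ' := (Equiv.addRight j).subtypeEquiv hm
  let E : (Λ → Fin d) ≃ (Λ' → Fin d) := Equiv.arrowCongr e (Equiv.refl _)
  rw [← vonNeumannEntropy_submatrix (isDensity_densityMatrix hω Λ') E]
  congr 1
  ext s t
  change ω (translate d j (localEmbed d Λ (Matrix.single t s 1)))
    = ω (localEmbed d Λ' (Matrix.single (E t) (E s) 1))
  congr 1
  apply Subtype.ext
  ext ψ σ
  change Unitary.conjStarAlgAut ℂ _ (shiftUnitary d j) (localOp (Matrix.single t s 1)) ψ σ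
    = localOp (Matrix.single (E t) (E s) 1) ψ σ
  rw [conj_shift_apply, localOp_single, localOp_single]
  have h1 : (fun z : Λ => shiftConfig d j σ z) = t ↔ (fun z : Λ' => σ z) = E t := by
    rw [← Equiv.symm_apply_eq]
    rfl
  simp only [h1]
  refine if_congr Iff.rfl ?_ rfl
  refine congrArg (ψ : Config d → ℂ) (funext fun z => ?_)
  rw [shiftConfig_symm_apply]
  have hz : z - j ∈ Λ ↔ z ∈ Λ' := by rw [hm, sub_add_cancel]
  by_cases h : z ∈ Λ'
  · have h' := hz.2 h
    simp only [override, h, h', dif_pos]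
    rfl
  · have h' : z - j ∉ Λ := fun h1 => h (hz.1 h1)
    simp [override, h, h', shiftConfig_apply]

/-- The entropy of the restriction of `ω` to the interval `[a, b)`. -/
noncomputable def intervalEntropy (ω : quasiLocal d →ₗ[ℂ] ℂ) (a b : ℤ) : ℝ :=
  vonNeumannEntropy (densityMatrix ω (Finset.Ico a b))

theorem intervalEntropy_shiftFunctional (hω : IsState ω) (j a b : ℤ) :
    intervalEntropy (shiftFunctional ω j) a b = intervalEntropy ω (a + j) (b + j) := by
  rw [intervalEntropy, vonNeumannEntropy_shiftFunctional hω, intervalEntropy]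
  have : (Finset.Ico a b).map (Equiv.addRight j).toEmbedding = Finset.Ico (a + j) (b + j) :=
    Finset.map_add_right_Ico a b j
  rw [this]

theorem intervalEntropy_nonneg (hω : IsState ω) (a b : ℤ) : 0 ≤ intervalEntropy ω a b :=
  vonNeumannEntropy_nonneg (isDensity_densityMatrix hω _)

theorem intervalEntropy_le_add (hω : IsState ω) {a b c : ℤ} (hab : a ≤ b) (hbc : b ≤ c) :
    intervalEntropy ω a c ≤ intervalEntropy ω a b + intervalEntropy ω b c := by
  refine vonNeumannEntropy_densityMatrix_le_add hω (Finset.Ico_disjoint_Ico_consecutive a b c) ?_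
  intro z
  simp only [Finset.mem_Ico]
  omega

theorem intervalEntropy_le (hω : IsState ω) {a b : ℤ} (hab : a ≤ b) :
    intervalEntropy ω a b ≤ Real.log d * ((b : ℝ) - a) := by
  refine (vonNeumannEntropy_le_log_card (isDensity_densityMatrix hω _)).trans_eq ?_
  have h : ((b - a).toNat : ℝ) = (b : ℝ) - a := by
    have := Int.toNat_of_nonneg (sub_nonneg.2 hab)
    exact_mod_cast congrArg (Int.cast : ℤ → ℝ) this
  simp only [Fintype.card_fun, Fintype.card_fin, Fintype.card_coe, Int.card_Ico, Nat.cast_pow,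
    Real.log_pow, h, mul_comm]

end RegionEntropy

/-- Averaging subadditivity over all tilings of an interval by intervals of length `M`. -/
theorem mul_le_sum_of_subadditive {e : ℤ → ℤ → ℝ} {c : ℝ} (hc : 0 ≤ c)
    (hnonneg : ∀ a b, 0 ≤ e a b) (hle : ∀ a b, a ≤ b → e a b ≤ c * ((b : ℝ) - a))
    (hadd : ∀ a b b', a ≤ b → b ≤ b' → e a b' ≤ e a b + e b b')
    (a : ℤ) {N M : ℕ} (hM : 0 < M) (hMN : M ≤ N) :
    M * e a (a + N) ≤ ∑ x ∈ Finset.range N, e (a + x) (a + x + M) + 2 * c * (M : ℝ) ^ 2 := by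
  -- Taking `K = N / M - 1` blocks, one fewer than fit, leaves room for every offset `r < M`, and
  -- the uncovered length is still at most `2 M`.
  obtain ⟨K, hK1, hK2⟩ : ∃ K : ℕ, K * M + M ≤ N ∧ N ≤ K * M + 2 * M := by
    refine ⟨N / M - 1, ?_, ?_⟩
    · have h1 : 1 ≤ N / M := (Nat.one_le_div_iff hM).2 hMN
      have h2 := Nat.div_mul_le_self N M
      rw [Nat.sub_mul, one_mul]
      have := Nat.mul_le_mul_right M h1
      omega
    · have h2 := Nat.lt_div_mul_add hM (a := N)
      rw [Nat.sub_mul, one_mul]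
      omega
  set f : ℕ → ℝ := fun x => e (a + x) (a + x + M) with hf
  have hblocks (r k : ℕ) : e (a + r) (a + r + (k * M : ℕ)) ≤
      ∑ i ∈ Finset.range k, f (i * M + r) := by
    induction k with
    | zero => simpa using hle (a + r) (a + r) le_rfl
    | succ k ih =>
      have h := hadd (a + r) (a + r + (k * M : ℕ)) (a + r + ((k + 1) * M : ℕ))
        (by omega) (by push_cast; nlinarith)
      rw [Finset.sum_range_succ]
      have h2 : f (k * M + r) = e (a + r + (k * M : ℕ)) (a + r + ((k + 1) * M : ℕ)) := by
        simp only [hf]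
        congr 1 <;> push_cast <;> ring
      linarith
  have hr (r : ℕ) (hr : r ∈ Finset.range M) :
      e a (a + N) ≤ ∑ i ∈ Finset.range K, f (i * M + r) + 2 * c * M := by
    have hr := Finset.mem_range.1 hr
    have h1 := hadd a (a + r) (a + N) (by omega) (by omega)
    have h2 := hadd (a + r) (a + r + (K * M : ℕ)) (a + N) (by omega) (by omega)
    have h3 := hle a (a + r) (by omega)
    have h4 := hle (a + r + (K * M : ℕ)) (a + N) (by omega)
    have h5 := hblocks r K
    have h6 : c * ((N : ℝ) - K * M) ≤ c * (2 * M) := by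
      refine mul_le_mul_of_nonneg_left ?_ hc
      have : (N : ℝ) ≤ K * M + 2 * M := by exact_mod_cast hK2
      linarith
    push_cast at *
    linarith
  -- Over all offsets `r`, the block starting points `i * M + r` run once through `[0, k M)`.
  have hsum (k : ℕ) : ∑ r ∈ Finset.range M, ∑ i ∈ Finset.range k, f (i * M + r)
      = ∑ x ∈ Finset.range (k * M), f x := by
    induction k with
    | zero => simp
    | succ k ih =>
      simp only [Finset.sum_range_succ, Finset.sum_add_distrib, ih]
      rw [add_mul, one_mul, Finset.sum_range_add]
  have h := Finset.sum_le_sum hr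
  rw [Finset.sum_add_distrib, hsum] at h
  simp only [Finset.sum_const, Finset.card_range, nsmul_eq_mul] at h
  have h7 : ∑ x ∈ Finset.range (K * M), f x ≤ ∑ x ∈ Finset.range N, f x :=
    Finset.sum_le_sum_of_subset_of_nonneg
      (Finset.range_subset_range.2 (by omega)) (fun _ _ _ => hnonneg _ _)
  nlinarith

/-! ### Normalized projections -/

section Projection

variable {ι : Type*} [Fintype ι]

theorem trace_nonneg_of_isStarProjection {p : Matrix ι ι ℂ} (hp : IsStarProjection p) :
    0 ≤ p.trace := by
  classical
  have h : p.trace = (p.conjTranspose * p).trace := by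
    rw [show p.conjTranspose = p from hp.isSelfAdjoint, hp.isIdempotentElem.eq]
  rw [h]
  exact (Matrix.posSemidef_conjTranspose_mul_self p).trace_nonneg

theorem trace_ne_zero_of_isStarProjection {p : Matrix ι ι ℂ} (hp : IsStarProjection p)
    (hp0 : p ≠ 0) : p.trace ≠ 0 := by
  have h : p.trace = (p.conjTranspose * p).trace := by
    rw [show p.conjTranspose = p from hp.isSelfAdjoint, hp.isIdempotentElem.eq]
  rw [h]
  exact fun h => hp0 (Matrix.trace_conjTranspose_mul_self_eq_zero_iff.1 h)

variable [DecidableEq ι]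

/-- With `t = Tr p`, the relation `ρ² = t⁻¹ ρ` leaves only the eigenvalues `0` and `t⁻¹`. Each
contributes `λ log t` to the entropy, and the eigenvalues sum to one. -/
theorem log_trace_le_vonNeumannEntropy {p : Matrix ι ι ℂ} (hp : IsStarProjection p)
    (hp0 : p ≠ 0) (hρ : IsDensity (p.trace⁻¹ • p)) :
    Real.log p.trace.re ≤ vonNeumannEntropy (p.trace⁻¹ • p) := by
  set t : ℝ := p.trace.re with ht
  have htr : p.trace = (t : ℂ) :=
    Complex.ext rfl (Complex.nonneg_iff.1 (trace_nonneg_of_isStarProjection hp)).2.symm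
  have ht0 : 0 < t := by
    refine lt_of_le_of_ne (Complex.nonneg_iff.1 (trace_nonneg_of_isStarProjection hp)).1 fun h => ?_
    exact trace_ne_zero_of_isStarProjection hp hp0 (by rw [htr, ← h, Complex.ofReal_zero])
  set ρ := p.trace⁻¹ • p with hρdef
  have hH := hρ.1.isHermitian
  have hsq : ρ * ρ = p.trace⁻¹ • ρ := by
    rw [hρdef, smul_mul_smul_comm, hp.isIdempotentElem.eq, smul_smul]
  have heig (i : ι) : hH.eigenvalues i = 0 ∨ hH.eigenvalues i = t⁻¹ := by
    set v := (hH.eigenvectorBasis i).ofLp with hv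
    have h1 : ρ.mulVec v = (hH.eigenvalues i : ℂ) • v := hH.mulVec_eigenvectorBasis i
    have hv0 : v ≠ 0 := by
      intro h0
      have := hH.eigenvectorBasis.orthonormal.ne_zero i
      exact this (by ext j; exact congrFun h0 j)
    have h2 : (ρ * ρ).mulVec v = ((hH.eigenvalues i : ℂ) * hH.eigenvalues i) • v := by
      rw [← Matrix.mulVec_mulVec, h1, Matrix.mulVec_smul, h1, smul_smul]
    rw [hsq, Matrix.smul_mulVec, h1, smul_smul, ← sub_eq_zero, ← sub_smul, smul_eq_zero] at h2
    have h3 := h2.resolve_right hv0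
    rw [htr, ← sub_mul, mul_eq_zero, sub_eq_zero] at h3
    rcases h3 with h3 | h3
    · right
      exact_mod_cast h3.symm
    · left
      exact_mod_cast h3
  rw [vonNeumannEntropy_eq_sum hH]
  have hterm (i : ι) : Real.negMulLog (hH.eigenvalues i) = hH.eigenvalues i * Real.log t := by
    rcases heig i with h | h <;> simp [h, Real.negMulLog]
  simp only [hterm, ← Finset.sum_mul]
  rw [show ∑ i, hH.eigenvalues i = 1 from hρ.sum_eigenvalues, one_mul]

end Projection

/-! ### The state of the chain given by a normalized projection -/

section ProjectionState

variable {d : ℕ} [NeZero d] {Λ : Finset ℤ}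

open Classical in
/-- The basis vector of `ℓ²` at the configuration `s` on `Λ`, continued by `0` outside `Λ`. -/
noncomputable def basisVec (s : Λ → Fin d) : HilbertSp d :=
  lp.single 2 (override (fun _ => 0) s) 1

open Classical in
theorem inner_basisVec (c : LocalAlg d Λ) (s : Λ → Fin d) :
    ⟪basisVec s, localRep d Λ c (basisVec s)⟫_ℂ = c s s := by
  have key (u : Λ → Fin d) :
      (basisVec s : HilbertSp d) (override (fun _ => 0) u) = if u = s then 1 else 0 := by
    rw [basisVec, lp.coeFn_single, Pi.single_apply]
    congr 1
    refine propext ⟨fun h => ?_, fun h => by rw [h]⟩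
    rw [← restrict_override (fun _ => 0) u, h, restrict_override]
  change ⟪lp.single 2 (override (fun _ => 0) s) (1 : ℂ), localOp c (basisVec s)⟫_ℂ = _
  rw [lp.inner_single_left, localOp_apply]
  simp [restrict_override, override_override, key]

/-- The state `a ↦ (Tr p)⁻¹ ∑ₛ ⟨p eₛ, a p eₛ⟩`, which extends `a ↦ Tr (p a) / Tr p`. -/
noncomputable def projectionState (p : LocalAlg d Λ) : quasiLocal d →ₗ[ℂ] ℂ where
  toFun a := p.trace⁻¹ * ∑ s : Λ → Fin d, ⟪localRep d Λ p (basisVec s),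
    (a : HilbertSp d →L[ℂ] HilbertSp d) (localRep d Λ p (basisVec s))⟫_ℂ
  map_add' a b := by
    simp [Finset.sum_add_distrib, mul_add]
  map_smul' c a := by
    simp only [SetLike.val_smul, smul_apply, inner_smul_right,
      ← Finset.mul_sum, RingHom.id_apply, smul_eq_mul]
    ring

theorem projectionState_apply (p : LocalAlg d Λ) (a : quasiLocal d) :
    projectionState p a = p.trace⁻¹ * ∑ s : Λ → Fin d, ⟪localRep d Λ p (basisVec s),
      (a : HilbertSp d →L[ℂ] HilbertSp d) (localRep d Λ p (basisVec s))⟫_ℂ := rfl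

/-- Since `p` is self-adjoint, `⟨p eₛ, a p eₛ⟩` is a diagonal entry of `p a p`; cyclicity of the
trace and `p² = p` finish. -/
theorem projectionState_localEmbed {p : LocalAlg d Λ} (hp : IsStarProjection p)
    (a : LocalAlg d Λ) : projectionState p (localEmbed d Λ a) = (p * a).trace / p.trace := by
  have h (s : Λ → Fin d) : ⟪localRep d Λ p (basisVec s),
      localRep d Λ a (localRep d Λ p (basisVec s))⟫_ℂ = (p * a * p) s s := by
    rw [← inner_basisVec (p * a * p), map_mul, map_mul, mul_apply_eq_comp, mul_apply_eq_comp]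
    have hadj : ContinuousLinearMap.adjoint (localRep d Λ p) = localRep d Λ p := by
      rw [← ContinuousLinearMap.star_eq_adjoint, ← map_star, hp.isSelfAdjoint.star_eq]
    rw [← ContinuousLinearMap.adjoint_inner_right, hadj]
  have h' : ∑ s, (p * a * p) s s = (p * a).trace := by
    change (p * a * p).trace = _
    rw [Matrix.trace_mul_comm, ← mul_assoc, hp.isIdempotentElem.eq]
  rw [projectionState_apply, div_eq_inv_mul, ← h']
  congr 1
  exact Finset.sum_congr rfl fun s _ => h s

theorem projectionState_one {p : LocalAlg d Λ} (hp : IsStarProjection p) (hp0 : p ≠ 0) :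
    projectionState p 1 = 1 := by
  rw [← map_one (localEmbed d Λ), projectionState_localEmbed hp, mul_one,
    div_self (trace_ne_zero_of_isStarProjection hp hp0)]

theorem isState_projectionState {p : LocalAlg d Λ} (hp : IsStarProjection p) (hp0 : p ≠ 0) :
    IsState (projectionState p) := by
  refine ⟨projectionState_one hp hp0, fun a => ?_⟩
  rw [projectionState_apply]
  refine mul_nonneg (inv_nonneg.2 (trace_nonneg_of_isStarProjection hp))
    (Finset.sum_nonneg fun s _ => ?_)
  change 0 ≤ ⟪_, (star (a : HilbertSp d →L[ℂ] HilbertSp d) * a) _⟫_ℂ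
  rw [mul_apply_eq_comp, ContinuousLinearMap.star_eq_adjoint,
    ContinuousLinearMap.adjoint_inner_right, inner_self_eq_norm_sq_to_K,
    ← RCLike.ofReal_pow]
  exact RCLike.ofReal_nonneg.2 (sq_nonneg _)

/-- Cauchy–Schwarz in each summand; the weights `‖p eₛ‖² / Tr p` sum to one because the functional
is normalized. This bound supplies the compactness for the limit. -/
theorem norm_projectionState_le {p : LocalAlg d Λ} (hp : IsStarProjection p) (hp0 : p ≠ 0)
    (a : quasiLocal d) : ‖projectionState p a‖ ≤ ‖a‖ := by
  have h1 : ‖p.trace⁻¹‖ * ∑ s : Λ → Fin d, ‖localRep d Λ p (basisVec s)‖ ^ 2 = 1 := by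
    have h := projectionState_one hp hp0
    have hre : p.trace⁻¹ = (‖p.trace⁻¹‖ : ℂ) :=
      Complex.eq_coe_norm_of_nonneg (inv_nonneg.2 (trace_nonneg_of_isStarProjection hp))
    rw [projectionState_apply, hre] at h
    have h' (s : Λ → Fin d) : ⟪localRep d Λ p (basisVec s),
        ((1 : quasiLocal d) : HilbertSp d →L[ℂ] HilbertSp d) (localRep d Λ p (basisVec s))⟫_ℂ
        = ((‖localRep d Λ p (basisVec s)‖ ^ 2 : ℝ) : ℂ) := by
      change ⟪_, localRep d Λ p (basisVec s)⟫_ℂ = _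
      rw [inner_self_eq_norm_sq_to_K]
      norm_cast
    simp only [h'] at h
    exact_mod_cast h
  rw [projectionState_apply, norm_mul]
  have h2 : ‖∑ s : Λ → Fin d, ⟪localRep d Λ p (basisVec s),
      (a : HilbertSp d →L[ℂ] HilbertSp d) (localRep d Λ p (basisVec s))⟫_ℂ‖
      ≤ (∑ s : Λ → Fin d, ‖localRep d Λ p (basisVec s)‖ ^ 2) * ‖a‖ := by
    rw [Finset.sum_mul]
    refine (norm_sum_le _ _).trans (Finset.sum_le_sum fun s _ => ?_)
    refine (norm_inner_le_norm _ _).trans ?_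
    have := (a : HilbertSp d →L[ℂ] HilbertSp d).le_opNorm (localRep d Λ p (basisVec s))
    calc _ ≤ ‖localRep d Λ p (basisVec s)‖ *
          (‖(a : HilbertSp d →L[ℂ] HilbertSp d)‖ * ‖localRep d Λ p (basisVec s)‖) :=
        mul_le_mul_of_nonneg_left this (norm_nonneg _)
      _ = _ := by
        rw [show ‖a‖ = ‖(a : HilbertSp d →L[ℂ] HilbertSp d)‖ from rfl]; ring
  calc _ ≤ ‖p.trace⁻¹‖ * ((∑ s : Λ → Fin d, ‖localRep d Λ p (basisVec s)‖ ^ 2) * ‖a‖) :=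
        mul_le_mul_of_nonneg_left h2 (norm_nonneg _)
    _ = _ := by rw [← mul_assoc, h1, one_mul]

theorem densityMatrix_projectionState {p : LocalAlg d Λ} (hp : IsStarProjection p) :
    densityMatrix (projectionState p) Λ = p.trace⁻¹ • p := by
  ext s t
  rw [densityMatrix, Matrix.of_apply, projectionState_localEmbed hp, div_eq_inv_mul,
    Matrix.smul_apply, smul_eq_mul, Matrix.trace_mul_single, MulOpposite.op_one, one_smul]

theorem log_trace_le_entropy_projectionState {p : LocalAlg d Λ} (hp : IsStarProjection p)
    (hp0 : p ≠ 0) :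
    Real.log p.trace.re ≤ vonNeumannEntropy (densityMatrix (projectionState p) Λ) := by
  have h := isDensity_densityMatrix (isState_projectionState hp hp0) Λ
  rw [densityMatrix_projectionState hp] at h ⊢
  exact log_trace_le_vonNeumannEntropy hp hp0 h

end ProjectionState

/-! ### Spatial averages of states -/

section Average

variable {d : ℕ}

theorem IsState.sum_smul {α : Type*} {s : Finset α} {c : α → ℝ} (hc : ∀ x ∈ s, 0 ≤ c x)
    (hc1 : ∑ x ∈ s, c x = 1) {φ : α → quasiLocal d →ₗ[ℂ] ℂ} (hφ : ∀ x ∈ s, IsState (φ x)) :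
    IsState (∑ x ∈ s, (c x : ℂ) • φ x) := by
  refine ⟨?_, fun a => ?_⟩
  · simp only [LinearMap.sum_apply, LinearMap.smul_apply, smul_eq_mul]
    rw [Finset.sum_congr rfl fun x hx => by rw [(hφ x hx).1, mul_one]]
    exact_mod_cast hc1
  · simp only [LinearMap.sum_apply, LinearMap.smul_apply, smul_eq_mul]
    refine Finset.sum_nonneg fun x hx => mul_nonneg ?_ ((hφ x hx).2 a)
    exact_mod_cast hc x hx

/-- The spatial average of a functional over the translations in `[-n, n]`. -/
noncomputable def averageState (φ : quasiLocal d →ₗ[ℂ] ℂ) (n : ℕ) : quasiLocal d →ₗ[ℂ] ℂ :=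
  ∑ x ∈ Finset.range (2 * n + 1),
    (((2 * (n : ℝ) + 1)⁻¹ : ℝ) : ℂ) • shiftFunctional φ (-(n : ℤ) + x)

theorem averageState_apply (φ : quasiLocal d →ₗ[ℂ] ℂ) (n : ℕ) (a : quasiLocal d) :
    averageState φ n a = (2 * (n : ℂ) + 1)⁻¹ *
      ∑ x ∈ Finset.range (2 * n + 1), φ (translate d (-(n : ℤ) + x) a) := by
  simp [averageState, LinearMap.sum_apply, shiftFunctional_apply, Finset.mul_sum]

theorem isState_averageState {φ : quasiLocal d →ₗ[ℂ] ℂ} (hφ : IsState φ) (n : ℕ) :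
    IsState (averageState φ n) := by
  refine IsState.sum_smul (c := fun _ => (2 * (n : ℝ) + 1)⁻¹) (fun _ _ => by positivity) ?_
    (fun x _ => hφ.shiftFunctional _)
  simp only [Finset.sum_const, Finset.card_range, nsmul_eq_mul]
  push_cast
  exact mul_inv_cancel₀ (by positivity)

theorem norm_translate_le (j : ℤ) (a : quasiLocal d) : ‖translate d j a‖ ≤ ‖a‖ := by
  change ‖Unitary.conjStarAlgAut ℂ _ (shiftUnitary d j) (a : HilbertSp d →L[ℂ] HilbertSp d)‖
    ≤ ‖(a : HilbertSp d →L[ℂ] HilbertSp d)‖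
  rw [Unitary.conjStarAlgAut_apply, ← Unitary.coe_star, CStarRing.norm_mul_coe_unitary,
    CStarRing.norm_coe_unitary_mul]

theorem norm_inv_two_mul_add_one (n : ℕ) : ‖(2 * (n : ℂ) + 1)⁻¹‖ = (2 * (n : ℝ) + 1)⁻¹ := by
  rw [norm_inv, show (2 * (n : ℂ) + 1) = ((2 * n + 1 : ℕ) : ℂ) by push_cast; rfl,
    Complex.norm_natCast]
  push_cast
  rfl

theorem norm_averageState_le {φ : quasiLocal d →ₗ[ℂ] ℂ} (hφ : ∀ a, ‖φ a‖ ≤ ‖a‖) (n : ℕ)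
    (a : quasiLocal d) : ‖averageState φ n a‖ ≤ ‖a‖ := by
  have hN : (0 : ℝ) < 2 * n + 1 := by positivity
  rw [averageState_apply, norm_mul, norm_inv_two_mul_add_one, inv_mul_le_iff₀ hN]
  refine (norm_sum_le_of_le _ fun x _ => (hφ _).trans (norm_translate_le _ a)).trans_eq ?_
  simp

/-- The difference of the two averages telescopes to its two boundary terms, each at most `‖a‖`. -/
theorem norm_averageState_translate_sub_le {φ : quasiLocal d →ₗ[ℂ] ℂ} (hφ : ∀ a, ‖φ a‖ ≤ ‖a‖)
    (n : ℕ) (a : quasiLocal d) :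
    ‖averageState φ n (translate d 1 a) - averageState φ n a‖
      ≤ (2 * (n : ℝ) + 1)⁻¹ * (2 * ‖a‖) := by
  have hN : (0 : ℝ) < 2 * n + 1 := by positivity
  rw [averageState_apply, averageState_apply, ← mul_sub, norm_mul, norm_inv_two_mul_add_one]
  refine mul_le_mul_of_nonneg_left ?_ (inv_nonneg.2 hN.le)
  have h (x : ℕ) : φ (translate d (-(n : ℤ) + x) (translate d 1 a))
      = φ (translate d (-(n : ℤ) + (x + 1 : ℕ)) a) := by
    rw [← translate_add]
    congr 2
    push_cast; ring_nf
  simp only [h]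
  rw [← Finset.sum_sub_distrib,
    Finset.sum_range_sub (fun x : ℕ => φ (translate d (-(n : ℤ) + x) a)), two_mul ‖a‖]
  exact (norm_sub_le _ _).trans (add_le_add ((hφ _).trans (norm_translate_le _ a))
    ((hφ _).trans (norm_translate_le _ a)))

theorem averageState_atOrigin (φ : quasiLocal d →ₗ[ℂ] ℂ) (n : ℕ) (A : Matrix (Fin d) (Fin d) ℂ) :
    averageState φ n (atOrigin A) = φ (localEmbed d (box n) (spatialMean n A)) := by
  rw [averageState_apply, spatialMean, map_smul, map_smul, smul_eq_mul, map_sum, map_sum]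
  congr 1
  simp only [localEmbed_siteMatrix]
  rw [Finset.sum_coe_sort (box n) (fun j => φ (translate d j (atOrigin A)))]
  refine Finset.sum_nbij (fun x : ℕ => -(n : ℤ) + x) ?_ ?_ ?_ (fun _ _ => rfl)
  · intro x hx
    simp only [Finset.mem_range, Finset.mem_Icc] at hx ⊢
    omega
  · intro x _ y _ h
    simpa using h
  · intro j hj
    simp only [Finset.coe_Icc, Set.mem_Icc, Finset.coe_range, Set.mem_image, Set.mem_Iio] at hj ⊢
    exact ⟨(j + n).toNat, by omega, by omega⟩

/-- `4 a = (1 + a)² - (1 - a)²` is a difference of positive elements. Needed because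
`entropyFunction` prescribes the expectations as complex numbers. -/
theorem im_eq_zero_of_isSelfAdjoint {ω : quasiLocal d →ₗ[ℂ] ℂ} (hω : IsState ω) {a : quasiLocal d}
    (ha : IsSelfAdjoint a) : (ω a).im = 0 := by
  have h := hω.2 (1 + a)
  have h' := hω.2 (1 - a)
  have e : star (1 + a) * (1 + a) - star (1 - a) * (1 - a) = (4 : ℂ) • a := by
    simp only [star_add, star_sub, star_one, ha.star_eq]
    rw [show (4 : ℂ) • a = a + a + a + a by module]
    noncomm_ring
  have h4 := congrArg (fun x => (ω x).im) e
  simp only [map_sub, map_smul, Complex.sub_im, smul_eq_mul, Complex.mul_im] at h4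
  rw [← (Complex.nonneg_iff.1 h).2, ← (Complex.nonneg_iff.1 h').2] at h4
  norm_num at h4
  exact h4

theorem isSelfAdjoint_atOrigin {A : Matrix (Fin d) (Fin d) ℂ} (hA : IsSelfAdjoint A) :
    IsSelfAdjoint (atOrigin A) := by
  rw [IsSelfAdjoint, atOrigin, ← map_star]
  congr 1
  ext s t
  have h (i j : Fin d) : star (A j i) = A i j := Matrix.ext_iff.2 hA.star_eq i j
  simp only [Matrix.star_apply, siteMatrix, Matrix.of_apply, apply_ite star, h, star_zero,
    eq_comm (a := t _) (b := s _)]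

/-- Tiling `[-n, n]` by translates of an interval of length `M`. -/
theorem mul_entropy_le_averageState {φ : quasiLocal d →ₗ[ℂ] ℂ} (hφ : IsState φ) {n M : ℕ}
    (hM : 0 < M) (hMn : M ≤ 2 * n + 1) :
    M * vonNeumannEntropy (densityMatrix φ (box n)) ≤
      (2 * (n : ℝ) + 1) * intervalEntropy (averageState φ n) 0 M
        + 2 * Real.log d * (M : ℝ) ^ 2 := by
  have hN : (0 : ℝ) < 2 * n + 1 := by positivity
  have h := mul_le_sum_of_subadditive (e := intervalEntropy φ) (c := Real.log d)
    (Real.log_natCast_nonneg d) (intervalEntropy_nonneg hφ)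
    (fun a b hab => intervalEntropy_le hφ hab)
    (fun a b b' hab hbb' => intervalEntropy_le_add hφ hab hbb') (-(n : ℤ)) hM hMn
  have hbox : Finset.Ico (-(n : ℤ)) (-(n : ℤ) + (2 * n + 1 : ℕ)) = box n := by
    ext z
    simp only [Finset.mem_Ico, Finset.mem_Icc]
    omega
  rw [intervalEntropy, hbox] at h
  refine h.trans (add_le_add_left ?_ _)
  have hshift (x : ℕ) : intervalEntropy φ (-(n : ℤ) + x) (-(n : ℤ) + x + M)
      = intervalEntropy (shiftFunctional φ (-(n : ℤ) + x)) 0 M := by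
    rw [intervalEntropy_shiftFunctional hφ, zero_add, add_comm (M : ℤ)]
  have hdm := densityMatrix_sum_smul (Finset.range (2 * n + 1))
    (fun _ => (((2 * (n : ℝ) + 1)⁻¹ : ℝ) : ℂ))
    (fun x : ℕ => shiftFunctional φ (-(n : ℤ) + x)) (Finset.Ico 0 (M : ℤ))
  have hd := isDensity_densityMatrix (isState_averageState hφ n) (Finset.Ico 0 (M : ℤ))
  rw [averageState, hdm] at hd
  -- Each block entropy is that of a translate of `φ` on the fixed block `[0, M)`, so concavity
  -- bounds their mean by the entropy of the average.
  have hconc := sum_vonNeumannEntropy_le (c := fun _ : ℕ => (2 * (n : ℝ) + 1)⁻¹)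
    (fun x _ => by positivity)
    (fun x _ => isDensity_densityMatrix (hφ.shiftFunctional (-(n : ℤ) + (x : ℕ))) _) hd
  simp only [hshift]
  rw [← Finset.mul_sum, inv_mul_le_iff₀ hN] at hconc
  rw [intervalEntropy, averageState, hdm]
  exact hconc

end Average

/-! ### Mean entropy and limits of spatial averages -/

section Limit

variable {d : ℕ}

/-- The mean entropy exists as a limit, so it inherits lower bounds on all intervals. -/
theorem le_meanEntropy {ω : quasiLocal d →ₗ[ℂ] ℂ} (hω : ω ∈ invariantStates d) {c : ℝ}
    (hc : ∀ M : ℕ, 0 < M → c * M ≤ intervalEntropy ω 0 M) : c ≤ meanEntropy ω := by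
  have hshift (j : ℤ) : shiftFunctional ω j = ω := LinearMap.ext fun a => hω.2 j a
  have htrans (j a b : ℤ) : intervalEntropy ω (a + j) (b + j) = intervalEntropy ω a b := by
    rw [← intervalEntropy_shiftFunctional hω.1, hshift]
  set u : ℕ → ℝ := fun N => intervalEntropy ω 0 N with hu
  have hsub : Subadditive u := fun a b => by
    have h := intervalEntropy_le_add hω.1 (a := 0) (b := a) (c := (a + b : ℕ))
      (by omega) (by omega)
    have h2 := htrans a 0 b
    rw [zero_add, show (b : ℤ) + a = ((a + b : ℕ) : ℤ) by push_cast; ring] at h2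
    rwa [h2] at h
  have hbdd : BddBelow (Set.range fun N => u N / N) :=
    ⟨0, by
      rintro _ ⟨N, rfl⟩
      exact div_nonneg (intervalEntropy_nonneg hω.1 _ _) (Nat.cast_nonneg N)⟩
  have hlim := hsub.tendsto_lim hbdd
  have h2n : Tendsto (fun n : ℕ => 2 * n + 1) atTop atTop :=
    tendsto_atTop_mono (fun n => by simp only [id]; omega) tendsto_id
  -- Boxes have the odd lengths `2n + 1`, so the mean entropy is a subsequential limit of the Fekete
  -- limit. Its convergence is what gives `limUnder` its value.
  have hmean : meanEntropy ω = hsub.lim := by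
    refine Tendsto.limUnder_eq ((hlim.comp h2n).congr fun n => ?_)
    have hbox : box n = Finset.Ico (0 + -(n : ℤ)) ((2 * n + 1 : ℕ) + -(n : ℤ)) := by
      ext z
      simp only [Finset.mem_Ico, Finset.mem_Icc]
      omega
    rw [hbox]
    change _ = _ * intervalEntropy ω _ _
    rw [htrans, Function.comp_apply, div_eq_inv_mul]
    push_cast
    rfl
  rw [hmean]
  refine ge_of_tendsto hlim ?_
  filter_upwards [eventually_gt_atTop 0] with N hN
  rw [le_div_iff₀ (by exact_mod_cast hN)]
  exact hc N hN

variable {α : Type*} {l : Filter α}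

/-- Pointwise limits of states are states. -/
theorem isState_of_tendsto [l.NeBot] {φ : α → quasiLocal d →ₗ[ℂ] ℂ} {ω : quasiLocal d →ₗ[ℂ] ℂ}
    (hφ : ∀ᶠ k in l, IsState (φ k)) (h : ∀ a, Tendsto (fun k => φ k a) l (𝓝 (ω a))) :
    IsState ω := by
  refine ⟨?_, fun a => ?_⟩
  · exact tendsto_nhds_unique (h 1)
      (tendsto_const_nhds.congr' (hφ.mono fun k hk => hk.1.symm))
  · exact ge_of_tendsto (h _) (hφ.mono fun k hk => hk.2 a)

/-- Bounded nets of functionals converge pointwise along ultrafilters. -/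
theorem exists_tendsto_of_norm_le (𝒰 : Ultrafilter α) {φ : α → quasiLocal d →ₗ[ℂ] ℂ}
    (hφ : ∀ᶠ k in 𝒰, ∀ a, ‖φ k a‖ ≤ ‖a‖) :
    ∃ ω : quasiLocal d →ₗ[ℂ] ℂ, ∀ a, Tendsto (fun k => φ k a) 𝒰 (𝓝 (ω a)) := by
  have h (a : quasiLocal d) : ∃ z, Tendsto (fun k => φ k a) 𝒰 (𝓝 z) := by
    obtain ⟨z, -, hz⟩ := (isCompact_closedBall (0 : ℂ) ‖a‖).ultrafilter_le_nhds
      (𝒰.map fun k => φ k a) (by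
        rw [le_principal_iff]
        exact hφ.mono fun k hk => mem_closedBall_zero_iff.2 (hk a))
    exact ⟨z, hz⟩
  choose F hF using h
  refine ⟨{ toFun := F, map_add' := fun a b => ?_, map_smul' := fun c a => ?_ }, hF⟩
  · refine tendsto_nhds_unique (hF (a + b)) (((hF a).add (hF b)).congr fun k => ?_)
    rw [map_add]
  · refine tendsto_nhds_unique (hF (c • a)) (((hF a).const_smul c).congr fun k => ?_)
    rw [map_smul]

theorem mem_invariantStates_of_translate_one {ω : quasiLocal d →ₗ[ℂ] ℂ} (hω : IsState ω)
    (h : ∀ a, ω (translate d 1 a) = ω a) : ω ∈ invariantStates d := by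
  refine ⟨hω, fun j a => ?_⟩
  have hstep (i : ℤ) : ω (translate d (1 + i) a) = ω (translate d i a) := by
    rw [translate_add, h]
  have h0 : ω (translate d 0 a) = ω a := by
    rw [← h (translate d 0 a), ← translate_add, add_zero, h]
  induction j using Int.induction_on with
  | zero => exact h0
  | succ i ih => rw [add_comm, hstep, ih]
  | pred i ih => rw [← hstep, add_sub_cancel, ih]

theorem tendsto_densityMatrix {φ : α → quasiLocal d →ₗ[ℂ] ℂ} {ω : quasiLocal d →ₗ[ℂ] ℂ}
    (h : ∀ a, Tendsto (fun k => φ k a) l (𝓝 (ω a))) (Λ : Finset ℤ) :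
    Tendsto (fun k => densityMatrix (φ k) Λ) l (𝓝 (densityMatrix ω Λ)) :=
  tendsto_pi_nhds.2 fun _ => tendsto_pi_nhds.2 fun _ => h _

/-- The heart of the argument: the ultrafilter limit of the averaged projection states keeps the
entropy density `c`, since for each fixed `M` the tiling bound passes to the limit on `[0, M)`. -/
theorem exists_invariantState_tendsto [NeZero d] (𝒰 : Ultrafilter α) {n : α → ℕ}
    (hn : Tendsto n 𝒰 atTop) {p : (k : α) → LocalAlg d (box (n k))}
    (hp : ∀ k, IsStarProjection (p k)) (hp0 : ∀ᶠ k in 𝒰, p k ≠ 0) {c : ℝ}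
    (hc : ∀ᶠ k in 𝒰, c ≤ (2 * (n k : ℝ) + 1)⁻¹ * Real.log (p k).trace.re) :
    ∃ ω ∈ invariantStates d, c ≤ meanEntropy ω ∧
      ∀ a, Tendsto (fun k => averageState (projectionState (p k)) (n k) a) 𝒰 (𝓝 (ω a)) := by
  have hnorm : ∀ᶠ k in 𝒰, ∀ a, ‖averageState (projectionState (p k)) (n k) a‖ ≤ ‖a‖ :=
    hp0.mono fun k hk => norm_averageState_le (norm_projectionState_le (hp k) hk) _
  obtain ⟨ω, hω⟩ := exists_tendsto_of_norm_le 𝒰 hnorm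
  have hstate : ∀ᶠ k in 𝒰, IsState (averageState (projectionState (p k)) (n k)) :=
    hp0.mono fun k hk => isState_averageState (isState_projectionState (hp k) hk) _
  have hωs : IsState ω := isState_of_tendsto hstate hω
  have hinv : Tendsto (fun k => (2 * (n k : ℝ) + 1)⁻¹) 𝒰 (𝓝 0) := by
    refine tendsto_inv_atTop_zero.comp (tendsto_atTop_add_const_right _ _ ?_)
    exact (tendsto_natCast_atTop_atTop.comp hn).const_mul_atTop two_pos
  have hmem : ω ∈ invariantStates d := by
    refine mem_invariantStates_of_translate_one hωs fun a => ?_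
    rw [← sub_eq_zero]
    refine tendsto_nhds_unique ((hω (translate d 1 a)).sub (hω a)) ?_
    refine squeeze_zero_norm' (hp0.mono fun k hk => norm_averageState_translate_sub_le
      (norm_projectionState_le (hp k) hk) (n k) a) ?_
    simpa using hinv.mul_const (2 * ‖a‖)
  refine ⟨ω, hmem, le_meanEntropy hmem fun M hM => ?_, hω⟩
  -- The slack `ε` is what upper semicontinuity requires; the tiling error is removed separately by
  -- letting `n k` tend to infinity.
  refine le_of_forall_pos_le_add fun ε hε => ?_
  have husc := eventually_vonNeumannEntropy_le
    (hstate.mono fun k hk => isDensity_densityMatrix hk (Finset.Ico 0 (M : ℤ)))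
    (isDensity_densityMatrix hωs _) (tendsto_densityMatrix hω _) hε
  have hMn : ∀ᶠ k in 𝒰, M ≤ 2 * n k + 1 :=
    (hn.eventually_ge_atTop M).mono fun k hk => by omega
  have hlim : Tendsto (fun k => intervalEntropy ω 0 M + ε
      + (2 * (n k : ℝ) + 1)⁻¹ * (2 * Real.log d * (M : ℝ) ^ 2)) 𝒰
      (𝓝 (intervalEntropy ω 0 M + ε)) := by
    simpa using (hinv.mul_const (2 * Real.log d * (M : ℝ) ^ 2)).const_add
      (intervalEntropy ω 0 M + ε)
  refine ge_of_tendsto hlim ?_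
  filter_upwards [husc, hMn, hc, hp0] with k hk hMk hck hpk
  have hN : (0 : ℝ) < 2 * n k + 1 := by positivity
  have h1 := mul_entropy_le_averageState (isState_projectionState (hp k) hpk) hM hMk
  have h2 := log_trace_le_entropy_projectionState (hp k) hpk
  have h3 : intervalEntropy (averageState (projectionState (p k)) (n k)) 0 M
      ≤ intervalEntropy ω 0 M + ε := hk
  rw [le_inv_mul_iff₀ hN] at hck
  rw [← sub_le_iff_le_add', le_inv_mul_iff₀ hN]
  have h4 := mul_le_mul_of_nonneg_left (hck.trans h2) (Nat.cast_nonneg (α := ℝ) M)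
  have h5 := mul_le_mul_of_nonneg_left h3 hN.le
  linarith

end Limit

/-! ### Expectations of the limit state and the entropy bound -/

theorem normalizedExpectation_eq {d m : ℕ} [NeZero d] (A : Fin m → Matrix (Fin d) (Fin d) ℂ)
    (n : ℕ) {p : LocalAlg d (box n)} (hp : IsStarProjection p) :
    normalizedExpectation A n p
      = WithLp.toLp 2 fun i => (averageState (projectionState p) n (atOrigin (A i))).re := by
  simp only [normalizedExpectation, averageState_atOrigin, projectionState_localEmbed hp]

end SpinChain

theorem lemma2p3 (d m : ℕ) (hd : 0 < d)
    (A : Fin m → Matrix (Fin d) (Fin d) ℂ) (hA : ∀ i, IsSelfAdjoint (A i))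
    (C : Set (EuclideanSpace ℝ (Fin m))) (hCne : C.Nonempty) (hCcpt : IsCompact C)
    (hCconv : Convex ℝ C)
    (n : ℕ → ℕ) (hn : StrictMono n)
    (p : (k : ℕ) → SpinChain.LocalAlg d (SpinChain.box (n k)))
    (hp : ∀ k, IsStarProjection (p k))
    (hexp : ∀ ε : ℝ, 0 < ε → ∀ᶠ k in Filter.atTop,
      p k ≠ 0 ∧ SpinChain.normalizedExpectation A (n k) (p k) ∈ Metric.thickening ε C) :
    Filter.limsup
        (fun k => (((2 * (n k : ℝ) + 1)⁻¹ * Real.log (p k).trace.re : ℝ) : EReal)) Filter.atTop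
      ≤ ⨆ x ∈ C, SpinChain.entropyFunction A x := by
  have : NeZero d := ⟨hd.ne'⟩
  refine le_of_forall_lt fun b hb => ?_
  obtain ⟨c, hbc, hc⟩ := EReal.lt_iff_exists_real_btwn.1 hb
  refine hbc.trans_le ?_
  -- The lower bound `c` holds only for infinitely many indices; the ultrafilter below concentrates
  -- on them.
  have hfreq := frequently_lt_of_lt_limsup (by isBoundedDefault) hc
  have : (atTop ⊓ 𝓟 {k : ℕ | (c : EReal) <
      (((2 * (n k : ℝ) + 1)⁻¹ * Real.log (p k).trace.re : ℝ) : EReal)}).NeBot :=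
    frequently_mem_iff_neBot.1 hfreq
  set 𝒰 := Ultrafilter.of (atTop ⊓ 𝓟 {k : ℕ | (c : EReal) <
      (((2 * (n k : ℝ) + 1)⁻¹ * Real.log (p k).trace.re : ℝ) : EReal)}) with h𝒰
  have hle := Ultrafilter.of_le (atTop ⊓ 𝓟 {k : ℕ | (c : EReal) <
      (((2 * (n k : ℝ) + 1)⁻¹ * Real.log (p k).trace.re : ℝ) : EReal)})
  have htop : (𝒰 : Filter ℕ) ≤ atTop := hle.trans inf_le_left
  have hc𝒰 : ∀ᶠ k in 𝒰, c ≤ (2 * (n k : ℝ) + 1)⁻¹ * Real.log (p k).trace.re := by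
    filter_upwards [hle.trans inf_le_right (mem_principal_self _)] with k hk
    exact (EReal.coe_lt_coe_iff.1 hk).le
  obtain ⟨ω, hω, hcω, hlim⟩ := SpinChain.exists_invariantState_tendsto 𝒰
    (hn.tendsto_atTop.mono_left htop) hp
    (((hexp 1 one_pos).mono fun k hk => hk.1).filter_mono htop) hc𝒰
  set x : EuclideanSpace ℝ (Fin m) :=
    WithLp.toLp 2 fun i => (ω (SpinChain.atOrigin (A i))).re with hx
  have htend : Tendsto (fun k => SpinChain.normalizedExpectation A (n k) (p k)) 𝒰 (𝓝 x) := by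
    simp only [SpinChain.normalizedExpectation_eq A _ (hp _)]
    refine ((PiLp.continuous_toLp 2 _).tendsto _).comp (tendsto_pi_nhds.2 fun i => ?_)
    exact (Complex.continuous_re.tendsto _).comp (hlim _)
  have hxC : x ∈ C := by
    -- A closed set is the intersection of its closed thickenings, and each of these eventually
    -- contains the approximating expectations.
    rw [← hCcpt.isClosed.closure_eq, Metric.closure_eq_iInter_cthickening]
    refine Set.mem_iInter₂.2 fun ε hε => ?_
    refine Metric.isClosed_cthickening.mem_of_tendsto htend ?_
    filter_upwards [(hexp ε hε).filter_mono htop] with k hk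
    exact Metric.thickening_subset_cthickening _ _ hk.2
  have hωx (i : Fin m) : ω (SpinChain.atOrigin (A i)) = (x i : ℂ) :=
    Complex.ext rfl (SpinChain.im_eq_zero_of_isSelfAdjoint hω.1
      (SpinChain.isSelfAdjoint_atOrigin (hA i)))
  calc (c : EReal) ≤ (SpinChain.meanEntropy ω : EReal) := EReal.coe_le_coe_iff.2 hcω
    _ ≤ SpinChain.entropyFunction A x :=
      le_iSup₂ (f := fun ω (_ : ω ∈ {ω ∈ SpinChain.invariantStates d |
        ∀ i, ω (SpinChain.atOrigin (A i)) = (x i : ℂ)}) => (SpinChain.meanEntropy ω : EReal))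
        ω ⟨hω, hωx⟩
    _ ≤ ⨆ x ∈ C, SpinChain.entropyFunction A x := le_iSup₂ (f := fun x (_ : x ∈ C) =>
        SpinChain.entropyFunction A x) x hxC
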